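/- Let $\mathbb D=\{z\in\mathbb C:|z|<1\}$, and let $\angle\lim$ denote the angular (non-tangential) limit. A one-parameter semigroup is a family $(\phi_t)_{t\ge0}$ of holomorphic self-maps of $\mathbb D$ with $\phi_0=\mathrm{id}$, $\phi_s\circ\phi_t=\phi_{s+t}$ and $\phi_t(z)\to z$ as $t\to0^+$ for every $z\in\mathbb D$. Its infinitesimal generator is the holomorphic function $G:\mathbb D\to\mathbb C$ with $\frac{d}{dt}\phi_t(z)=G(\phi_t(z))$ for all $z\in\mathbb D$, $t\ge0$. The Denjoy--Wolff point (DW-point) of a holomorphic $\varphi:\mathbb D\to\mathbb D$, $\varphi\ne\mathrm{id}$, is its unique fixed point $\tau\in\mathbb D$ if it has one, and otherwise the unique boundary regular fixed point $\tau\in\partial\mathbb D$ with $\varphi'(\tau)\le1$; here $\sigma\in\partial\mathbb D$ is a boundary regular fixed point (BRFP) of $\varphi$ if $\angle\lim_{z\to\sigma}\varphi(z)=\sigma$ and $\varphi'(\sigma):=\angle\lim_{z\to\sigma}\frac{\varphi(z)-\sigma}{z-\sigma}$ exists finitely. The DW-point of a non-trivial semigroup $(\phi_t)$ is the common DW-point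 of all $\phi_t\neq\mathrm{id}$, and $\sigma$ is a BRFP of $(\phi_t)$ if it is a BRFP of every $\phi_t$, $t\ge0$. The spectral value of the semigroup at a BRFP $\sigma$ is $\angle\lim_{z\to\sigma}\frac{G(z)}{\sigma-z}$. A Herglotz function is a holomorphic $p:\mathbb D\to\mathbb C$ with $\operatorname{Re}p\ge0$; for $\sigma\in\partial\mathbb D$ put $p^\star(\sigma):=\angle\lim_{z\to\sigma}(1-\bar\sigma z)p(z)$ (this limit always exists). Let $n\ge1$, let $\sigma_1,\dots,\sigma_n\in\partial\mathbb D$ be pairwise distinct, $F=\{\sigma_1,\dots,\sigma_n\}$, let $\tau\in\overline{\mathbb D}\setminus F$ and $\Lambda=(\lambda_1,\dots,\lambda_n)\in(-\infty,0)^n$. Let $\mathsf{Gen}_\tau(F,\Lambda)$ be the set of infinitesimal generators $G$ that are either identically zero or generate a semigroup with DW-point $\tau$, and whose semigroup has BRFPs $\sigma_1,\dots,\sigma_n$ with spectral values $\lambda'_1,\dots,\lambda'_n$ satisfying $\lambda_k\le\lambda'_k\le0$ for all $k$. Let $\mathsf{Gen}'_\tau(F,\Lambda)$ be the subset of those $G$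 for which $\lambda'_k=\lambda_k$ for all $k$. Put $$p_0(z;F,\Lambda):=\sum_{k=1}^n\alpha_k\frac{\sigma_k+z}{\sigma_k-z},\qquad \alpha_k:=\frac{|\tau-\sigma_k|^2}{2|\lambda_k|}.$$ **Theorem.** Let $G:\mathbb D\to\mathbb C$. (A) $G\in\mathsf{Gen}_\tau(F,\Lambda)$ and $G\not\equiv0$ if and only if there exists a Herglotz function $p$ such that $$G(z)=\frac{(\tau-z)(1-\bar\tau z)}{p(z)+p_0(z;F,\Lambda)}\quad\text{for all }z\in\mathbb D.\qquad(*)$$ (B) $G\in\mathsf{Gen}'_\tau(F,\Lambda)$ if and only if $(*)$ holds with some Herglotz function $p$ satisfying $p^\star(\sigma_k)=0$ for all $k=1,\dots,n$. -/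

import Mathlib

open Filter Topology Metric
open scoped ComplexConjugate

namespace DiskSemigroup

/-- The open unit disk. Functions on the disk are modelled by functions `ℂ → ℂ` of which only the
values on `𝔻` are used. -/
abbrev disk : Set ℂ := ball (0 : ℂ) 1

/-- The Stolz (non-tangential approach) region of aperture `M` at the boundary point `σ`. -/
def stolz (σ : ℂ) (M : ℝ) : Set ℂ := {z | ‖z‖ < 1 ∧ ‖σ - z‖ < M * (1 - ‖z‖)}

/-- The filter of non-tangential approach to `σ ∈ ∂𝔻`: a function has angular limit `l` at `σ` iff
it tends to `l` as `z → σ` inside every Stolz region at `σ`. -/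
noncomputable def angular (σ : ℂ) : Filter ℂ := ⨆ M : ℝ, 𝓝[stolz σ M] σ

/-- `p` is a Herglotz function. -/
structure IsHerglotz (p : ℂ → ℂ) : Prop where
  holo : DifferentiableOn ℂ p disk
  re_nonneg : ∀ z ∈ disk, 0 ≤ (p z).re

/-- `p⋆(σ) = c`, that is, `(1 - conj σ * z) * p z` has angular limit `c` at `σ`. -/
def HasStar (p : ℂ → ℂ) (σ c : ℂ) : Prop :=
  Tendsto (fun z => (1 - conj σ * z) * p z) (angular σ) (𝓝 c)

/-- `σ ∈ ∂𝔻` is a boundary fixed point of `f` with (finite) angular derivative `a`. -/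
structure HasBRFPWithDeriv (f : ℂ → ℂ) (σ a : ℂ) : Prop where
  norm_eq : ‖σ‖ = 1
  fixed : Tendsto f (angular σ) (𝓝 σ)
  angularDeriv : Tendsto (fun z => (f z - σ) / (z - σ)) (angular σ) (𝓝 a)

/-- `σ` is a boundary regular fixed point of `f`. -/
def IsBRFP (f : ℂ → ℂ) (σ : ℂ) : Prop := ∃ a : ℂ, HasBRFPWithDeriv f σ a

/-- `τ` is the Denjoy--Wolff point of the holomorphic self-map `f ≠ id` of the disk. -/
def IsDWPoint (f : ℂ → ℂ) (τ : ℂ) : Prop :=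
  (τ ∈ disk ∧ f τ = τ ∧ (∀ w ∈ disk, f w = w → w = τ) ∧ ‖deriv f τ‖ ≤ 1) ∨
  ((∀ w ∈ disk, f w ≠ w) ∧ ∃ a : ℝ, HasBRFPWithDeriv f τ a ∧ a ≤ 1)

/-- `(φ t)`, `t ≥ 0`, is a one-parameter semigroup of holomorphic self-maps of the disk. -/
structure IsSemigroup (φ : ℝ → ℂ → ℂ) : Prop where
  holo : ∀ t, 0 ≤ t → DifferentiableOn ℂ (φ t) disk
  mapsTo : ∀ t, 0 ≤ t → Set.MapsTo (φ t) disk disk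
  zero : ∀ z ∈ disk, φ 0 z = z
  add : ∀ s t, 0 ≤ s → 0 ≤ t → ∀ z ∈ disk, φ (s + t) z = φ s (φ t z)
  continuous_zero : ∀ z ∈ disk, Tendsto (fun t => φ t z) (𝓝[>] 0) (𝓝 z)

/-- `G` is the infinitesimal generator of the one-parameter semigroup `φ`. -/
structure IsGeneratorOf (G : ℂ → ℂ) (φ : ℝ → ℂ → ℂ) : Prop where
  semigroup : IsSemigroup φ
  holo : DifferentiableOn ℂ G disk
  flow : ∀ z ∈ disk, ∀ t, 0 ≤ t →
    HasDerivWithinAt (fun s => φ s z) (G (φ t z)) (Set.Ici 0) t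

/-- `τ` is the Denjoy--Wolff point of the non-trivial one-parameter semigroup `φ`: it is the
Denjoy--Wolff point of every element different from the identity. -/
def IsSemigroupDWPoint (φ : ℝ → ℂ → ℂ) (τ : ℂ) : Prop :=
  (∃ t, 0 < t ∧ ¬ Set.EqOn (φ t) id disk) ∧
  ∀ t, 0 < t → ¬ Set.EqOn (φ t) id disk → IsDWPoint (φ t) τ

/-- `σ` is a boundary regular fixed point of the one-parameter semigroup `φ`. -/
def IsSemigroupBRFP (φ : ℝ → ℂ → ℂ) (σ : ℂ) : Prop := ∀ t, 0 ≤ t → IsBRFP (φ t) σ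

/-- `l` is the spectral value, at the boundary regular fixed point `σ`, of the one-parameter
semigroup generated by `G`. -/
def HasSpectralValue (G : ℂ → ℂ) (σ : ℂ) (l : ℝ) : Prop :=
  Tendsto (fun z => G z / (σ - z)) (angular σ) (𝓝 (l : ℂ))

/-- The class `Gen_τ(F, Λ)`. The zero generator is, by convention, admitted for every `τ`. -/
def Gen {n : ℕ} (τ : ℂ) (σ : Fin n → ℂ) (lam : Fin n → ℝ) : Set (ℂ → ℂ) :=
  {G | ∃ φ : ℝ → ℂ → ℂ, IsGeneratorOf G φ ∧
    (Set.EqOn G 0 disk ∨ IsSemigroupDWPoint φ τ) ∧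
    ∀ k, IsSemigroupBRFP φ (σ k) ∧
      ∃ l : ℝ, HasSpectralValue G (σ k) l ∧ lam k ≤ l ∧ l ≤ 0}

/-- The class `Gen'_τ(F, Λ)`: the spectral values are exactly the given ones. -/
def Gen' {n : ℕ} (τ : ℂ) (σ : Fin n → ℂ) (lam : Fin n → ℝ) : Set (ℂ → ℂ) :=
  {G | G ∈ Gen τ σ lam ∧ ∀ k, HasSpectralValue G (σ k) (lam k)}

/-- The coefficient `α_k = |τ - σ_k|² / (2 |λ_k|)`. -/
noncomputable def alpha (τ σ : ℂ) (l : ℝ) : ℝ := ‖τ - σ‖ ^ 2 / (2 * |l|)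

/-- The function `p_0(z; F, Λ)`. -/
noncomputable def p0 {n : ℕ} (τ : ℂ) (σ : Fin n → ℂ) (lam : Fin n → ℝ) (z : ℂ) : ℂ :=
  ∑ k, (alpha τ (σ k) (lam k) : ℂ) * ((σ k + z) / (σ k - z))

/-- The representation `G(z) = (τ - z)(1 - conj τ * z) / (p(z) + p_0(z; F, Λ))` on the disk. -/
def Represents {n : ℕ} (τ : ℂ) (σ : Fin n → ℂ) (lam : Fin n → ℝ) (p G : ℂ → ℂ) : Prop :=
  ∀ z ∈ disk, G z = (τ - z) * (1 - conj τ * z) / (p z + p0 τ σ lam z)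

end DiskSemigroup

/-!
Let `P` be a Herglotz function and `σ` a boundary point. Subtracting multiples of the Cayley
kernel `(σ + z) / (σ - z)` from `P` as long as the real part stays nonnegative removes exactly the
atom of `P` at `σ`, and the Schwarz–Pick inequality shows that a Herglotz function without such a
multiple has angular limit `(1 - conj σ * z) * P z → 0`. This is the Julia–Carathéodory theorem.

By Julia's lemma the Poisson kernel `(1 - |z|²) / |τ - z|²` increases along the trajectories of a
semigroup with Denjoy–Wolff point `τ`; differentiating at time zero gives the Berkson–Porta formula
`G z = (τ - z) * (1 - conj τ * z) * q z` with `q` Herglotz. Conversely, such a `G` has a radial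
component that is bounded above near the circle, which prevents trajectories from escaping, so that
it generates a semigroup.

Write `P = 1 / q`. Then `(1 - conj σ * z) * P z * (G z / (σ - z))` tends to `-|τ - σ|²`, so the
spectral value at `σ` and the atom of `P` have product `-|τ - σ|²`. Hence the spectral value at
`σ k` is at least `lam k` if and only if the atom of `P` there is at least the one of `p0`. Since
atoms can be split off one at a time, this happens at all `σ k` if and only if `P - p0` is Herglotz,
and the spectral values are equal to `lam k` exactly when `P - p0` has no atom at `σ k`.
-/

namespace DiskSemigroup

open Set

theorem mem_disk {z : ℂ} : z ∈ disk ↔ ‖z‖ < 1 := mem_ball_zero_iff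

theorem zero_mem_disk : (0 : ℂ) ∈ disk := mem_ball_self one_pos

theorem isOpen_disk : IsOpen disk := isOpen_ball

theorem disk_mem_nhds {z : ℂ} (hz : z ∈ disk) : disk ∈ 𝓝 z := isOpen_disk.mem_nhds hz

theorem one_sub_norm_sq_pos {z : ℂ} (hz : z ∈ disk) : 0 < 1 - ‖z‖ ^ 2 :=
  sub_pos.2 (pow_lt_one₀ (norm_nonneg z) (mem_disk.1 hz) two_ne_zero)

theorem one_sub_conj_mul_ne_zero {z w : ℂ} (hz : z ∈ disk) (hw : ‖w‖ ≤ 1) :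
    1 - conj w * z ≠ 0 := by
  refine sub_ne_zero.2 fun h => (mul_lt_one_of_nonneg_of_lt_one_right hw (norm_nonneg z)
    (mem_disk.1 hz)).ne ?_
  rw [← Complex.norm_conj w, ← norm_mul, ← h, norm_one]

theorem norm_sq_one_sub_conj_mul_sub (z w : ℂ) :
    ‖1 - conj w * z‖ ^ 2 - ‖z - w‖ ^ 2 = (1 - ‖z‖ ^ 2) * (1 - ‖w‖ ^ 2) := by
  simp only [Complex.sq_norm, Complex.normSq_apply, Complex.sub_re, Complex.sub_im,
    Complex.mul_re, Complex.mul_im, Complex.conj_re, Complex.conj_im, Complex.one_re,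
    Complex.one_im]
  ring

theorem norm_sq_add_conj_sub (a b : ℂ) :
    ‖a + conj b‖ ^ 2 - ‖a - b‖ ^ 2 = 4 * a.re * b.re := by
  simp only [Complex.sq_norm, Complex.normSq_apply, Complex.add_re, Complex.add_im,
    Complex.sub_re, Complex.sub_im, Complex.conj_re, Complex.conj_im]
  ring

/-- The Möbius automorphism of the disk that takes `w` to `0`. -/
noncomputable def mobius (w z : ℂ) : ℂ := (z - w) / (1 - conj w * z)

theorem one_sub_norm_mobius_sq {w z : ℂ} (hw : w ∈ disk) (hz : z ∈ disk) :
    1 - ‖mobius w z‖ ^ 2 = (1 - ‖z‖ ^ 2) * (1 - ‖w‖ ^ 2) / ‖1 - conj w * z‖ ^ 2 := by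
  have hne := pow_ne_zero 2 (norm_ne_zero_iff.2 (one_sub_conj_mul_ne_zero hz (mem_disk.1 hw).le))
  rw [mobius, norm_div, div_pow, one_sub_div hne, norm_sq_one_sub_conj_mul_sub]

theorem mapsTo_mobius {w : ℂ} (hw : w ∈ disk) : MapsTo (mobius w) disk disk := by
  intro z hz
  have hne := norm_pos_iff.2 (one_sub_conj_mul_ne_zero hz (mem_disk.1 hw).le)
  have hpos : 0 < 1 - ‖mobius w z‖ ^ 2 := by
    rw [one_sub_norm_mobius_sq hw hz]
    have := one_sub_norm_sq_pos hz
    have := one_sub_norm_sq_pos hw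
    positivity
  exact mem_disk.2 (lt_of_pow_lt_pow_left₀ 2 zero_le_one (by linarith))

theorem differentiableOn_mobius {w : ℂ} (hw : w ∈ disk) : DifferentiableOn ℂ (mobius w) disk :=
  DifferentiableOn.div (by fun_prop) (by fun_prop) fun _ hz =>
    one_sub_conj_mul_ne_zero hz (mem_disk.1 hw).le

theorem mobius_neg_mobius {w z : ℂ} (hw : w ∈ disk) (hz : z ∈ disk) :
    mobius (-w) (mobius w z) = z := by
  have hwz : 1 - conj w * z ≠ 0 := one_sub_conj_mul_ne_zero hz (mem_disk.1 hw).le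
  have hww : 1 - conj w * w ≠ 0 := one_sub_conj_mul_ne_zero hw (mem_disk.1 hw).le
  have hnum : mobius w z - -w = z * (1 - conj w * w) / (1 - conj w * z) := by
    rw [mobius, eq_div_iff hwz, sub_mul, div_mul_cancel₀ _ hwz]; ring
  have hden : 1 - conj (-w) * mobius w z = (1 - conj w * w) / (1 - conj w * z) := by
    rw [mobius, map_neg]; field_simp; ring
  rw [mobius, hnum, hden, div_div_div_cancel_right₀ hwz, mul_div_cancel_right₀ _ hww]

/-! ### The Schwarz–Pick lemma for self-maps of the disk and for Herglotz functions -/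

theorem norm_le_norm_mobius {E : Type*} [NormedAddCommGroup E] [NormedSpace ℂ E] {g : ℂ → E}
    (hg : DifferentiableOn ℂ g disk)
    (hmaps : MapsTo g disk (closedBall 0 1)) {w : ℂ} (hw : w ∈ disk) (h0 : g w = 0) {z : ℂ}
    (hz : z ∈ disk) : ‖g z‖ ≤ ‖mobius w z‖ := by
  have hw' : -w ∈ disk := by simpa using hw
  have hcomp := Complex.norm_le_norm_of_mapsTo_ball
    (hg.comp (differentiableOn_mobius hw') (mapsTo_mobius hw'))
    (hmaps.comp (mapsTo_mobius hw')) (by simp [mobius, h0]) (mem_disk.1 (mapsTo_mobius hw hz))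
  rwa [Function.comp_apply, mobius_neg_mobius hw hz] at hcomp

section SelfMap

variable {f : ℂ → ℂ} (hf : DifferentiableOn ℂ f disk) (hmaps : MapsTo f disk disk) {z w : ℂ}
include hf hmaps

theorem norm_mobius_le_norm_mobius (hz : z ∈ disk) (hw : w ∈ disk) :
    ‖mobius (f w) (f z)‖ ≤ ‖mobius w z‖ :=
  norm_le_norm_mobius ((differentiableOn_mobius (hmaps hw)).comp hf hmaps)
    (((mapsTo_mobius (hmaps hw)).comp hmaps).mono_right ball_subset_closedBall) hw
    (by simp [mobius]) hz

theorem one_sub_norm_sq_mul_le (hz : z ∈ disk) (hw : w ∈ disk) :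
    (1 - ‖z‖ ^ 2) * (1 - ‖w‖ ^ 2) * ‖1 - conj (f w) * f z‖ ^ 2
      ≤ (1 - ‖f z‖ ^ 2) * (1 - ‖f w‖ ^ 2) * ‖1 - conj w * z‖ ^ 2 := by
  have hne := norm_pos_iff.2 (one_sub_conj_mul_ne_zero hz (mem_disk.1 hw).le)
  have hfne := norm_pos_iff.2 (one_sub_conj_mul_ne_zero (hmaps hz) (mem_disk.1 (hmaps hw)).le)
  rw [← div_le_div_iff₀ (by positivity) (by positivity), ← one_sub_norm_mobius_sq hw hz,
    ← one_sub_norm_mobius_sq (hmaps hw) (hmaps hz)]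
  gcongr
  exact norm_mobius_le_norm_mobius hf hmaps hz hw

theorem norm_deriv_le_one_of_fixed (hw : w ∈ disk) (hfix : f w = w) : ‖deriv f w‖ ≤ 1 := by
  have hfw := (hf.differentiableAt (disk_mem_nhds hw)).hasDerivAt
  have hne : 1 - conj w * w ≠ 0 := one_sub_conj_mul_ne_zero hw (mem_disk.1 hw).le
  have hslope := (hasDerivAt_iff_tendsto_slope.1 hfw).norm
  have hbound : Tendsto (fun z => ‖1 - conj w * f z‖ / ‖1 - conj w * z‖) (𝓝[≠] w) (𝓝 1) := by
    have := hfw.continuousAt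
    have hcont : ContinuousAt (fun z => ‖1 - conj w * f z‖ / ‖1 - conj w * z‖) w :=
      ContinuousAt.div (by fun_prop) (by fun_prop) (norm_ne_zero_iff.2 hne)
    have hlim := hcont.tendsto
    rw [hfix, div_self (norm_ne_zero_iff.2 hne)] at hlim
    exact hlim.mono_left nhdsWithin_le_nhds
  refine le_of_tendsto_of_tendsto hslope hbound ?_
  filter_upwards [self_mem_nhdsWithin, nhdsWithin_le_nhds (disk_mem_nhds hw)] with z hzw hz
  have hpick := norm_mobius_le_norm_mobius hf hmaps hz hw
  have hzw' : 0 < ‖z - w‖ := norm_pos_iff.2 (sub_ne_zero.2 hzw)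
  have hfz := norm_pos_iff.2 (one_sub_conj_mul_ne_zero (hmaps hz) (mem_disk.1 hw).le)
  rw [hfix, mobius, mobius, norm_div, norm_div, div_le_iff₀ hfz] at hpick
  rw [slope_def_field, norm_div, hfix, div_le_iff₀ hzw']
  exact hpick.trans_eq (by ring)

end SelfMap

namespace IsHerglotz

variable {p q : ℂ → ℂ} {z w : ℂ}

theorem add (hp : IsHerglotz p) (hq : IsHerglotz q) : IsHerglotz (fun z => p z + q z) :=
  ⟨hp.holo.add hq.holo, fun z hz => by
    rw [Complex.add_re]; exact add_nonneg (hp.re_nonneg z hz) (hq.re_nonneg z hz)⟩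

theorem ofReal_mul (hp : IsHerglotz p) {a : ℝ} (ha : 0 ≤ a) :
    IsHerglotz (fun z => (a : ℂ) * p z) :=
  ⟨hp.holo.const_mul _, fun z hz => by
    rw [Complex.re_ofReal_mul]; exact mul_nonneg ha (hp.re_nonneg z hz)⟩

theorem ofReal_add (hp : IsHerglotz p) {a : ℝ} (ha : 0 ≤ a) :
    IsHerglotz (fun z => (a : ℂ) + p z) :=
  ⟨hp.holo.const_add _, fun z hz => by
    rw [Complex.add_re, Complex.ofReal_re]; exact add_nonneg ha (hp.re_nonneg z hz)⟩

theorem norm_sq_add_conj_mul_le_of_pos (hp : IsHerglotz p) (hz : z ∈ disk) (hw : w ∈ disk)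
    (hpos : 0 < (p w).re) :
    (1 - ‖z‖ ^ 2) * (1 - ‖w‖ ^ 2) * ‖p z + conj (p w)‖ ^ 2
      ≤ 4 * (p z).re * (p w).re * ‖1 - conj w * z‖ ^ 2 := by
  have hne : ∀ ζ ∈ disk, p ζ + conj (p w) ≠ 0 := fun ζ hζ h => by
    have hre := congrArg Complex.re h
    rw [Complex.add_re, Complex.conj_re, Complex.zero_re] at hre
    linarith [hp.re_nonneg ζ hζ]
  have hball : MapsTo (fun ζ => (p ζ - p w) / (p ζ + conj (p w))) disk (closedBall 0 1) := by
    intro ζ hζ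
    have hre : 0 ≤ 4 * (p ζ).re * (p w).re := by have := hp.re_nonneg ζ hζ; positivity
    rw [mem_closedBall_zero_iff, norm_div]
    refine div_le_one_of_le₀ ((sq_le_sq₀ (norm_nonneg _) (norm_nonneg _)).1 ?_) (norm_nonneg _)
    linarith [norm_sq_add_conj_sub (p ζ) (p w)]
  have hpick := norm_le_norm_mobius ((hp.holo.sub_const _).div (hp.holo.add_const _) hne) hball hw
    (by simp) hz
  have hden := norm_pos_iff.2 (hne z hz)
  have hden' := norm_pos_iff.2 (one_sub_conj_mul_ne_zero hz (mem_disk.1 hw).le)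
  rw [← norm_sq_add_conj_sub, ← div_le_div_iff₀ (by positivity) (by positivity),
    ← one_sub_norm_mobius_sq hw hz, sub_div, div_self (by positivity), ← div_pow, ← norm_div]
  gcongr
  exact hpick

theorem norm_sq_add_conj_mul_le (hp : IsHerglotz p) (hz : z ∈ disk) (hw : w ∈ disk) :
    (1 - ‖z‖ ^ 2) * (1 - ‖w‖ ^ 2) * ‖p z + conj (p w)‖ ^ 2
      ≤ 4 * (p z).re * (p w).re * ‖1 - conj w * z‖ ^ 2 := by
  have hperturbed : ∀ᶠ ε : ℝ in 𝓝[>] 0,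
      (1 - ‖z‖ ^ 2) * (1 - ‖w‖ ^ 2) * ‖(ε + p z : ℂ) + conj (ε + p w)‖ ^ 2
        ≤ 4 * (ε + p z : ℂ).re * (ε + p w : ℂ).re * ‖1 - conj w * z‖ ^ 2 := by
    filter_upwards [self_mem_nhdsWithin] with ε (hε : 0 < ε)
    refine (hp.ofReal_add hε.le).norm_sq_add_conj_mul_le_of_pos hz hw ?_
    rw [Complex.add_re, Complex.ofReal_re]
    linarith [hp.re_nonneg w hw]
  have hlim := le_of_tendsto_of_tendsto
    (tendsto_nhdsWithin_of_tendsto_nhds (Continuous.tendsto (by fun_prop) 0))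
    (tendsto_nhdsWithin_of_tendsto_nhds (Continuous.tendsto (by fun_prop) 0)) hperturbed
  simpa only [Complex.ofReal_zero, zero_add] using hlim

theorem norm_add_conj_mul_le (hp : IsHerglotz p) (hz : z ∈ disk) (hw : w ∈ disk) :
    (1 - ‖z‖ ^ 2) * (1 - ‖w‖ ^ 2) * ‖p z + conj (p w)‖
      ≤ 4 * (p w).re * ‖1 - conj w * z‖ ^ 2 := by
  have hpw := hp.re_nonneg w hw
  have hre : (p z).re ≤ ‖p z + conj (p w)‖ :=
    (le_add_of_nonneg_right hpw).trans (Complex.re_le_norm (p z + conj (p w)))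
  rcases (norm_nonneg (p z + conj (p w))).eq_or_lt with hzero | hpos
  · rw [← hzero, mul_zero]
    positivity
  · refine le_of_mul_le_mul_right ?_ hpos
    calc (1 - ‖z‖ ^ 2) * (1 - ‖w‖ ^ 2) * ‖p z + conj (p w)‖ * ‖p z + conj (p w)‖
        = (1 - ‖z‖ ^ 2) * (1 - ‖w‖ ^ 2) * ‖p z + conj (p w)‖ ^ 2 := by ring
      _ ≤ 4 * (p z).re * (p w).re * ‖1 - conj w * z‖ ^ 2 := hp.norm_sq_add_conj_mul_le hz hw
      _ ≤ 4 * ‖p z + conj (p w)‖ * (p w).re * ‖1 - conj w * z‖ ^ 2 := by gcongr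
      _ = 4 * (p w).re * ‖1 - conj w * z‖ ^ 2 * ‖p z + conj (p w)‖ := by ring

theorem eqOn_zero (hp : IsHerglotz p) (hw : w ∈ disk) (h0 : p w = 0) : EqOn p 0 disk := by
  intro z hz
  have hle := hp.norm_add_conj_mul_le hz hw
  simp only [h0, map_zero, add_zero, Complex.zero_re, mul_zero, zero_mul] at hle
  have hpos := mul_pos (one_sub_norm_sq_pos hz) (one_sub_norm_sq_pos hw)
  exact norm_le_zero_iff.1 (nonpos_of_mul_nonpos_right hle hpos)

end IsHerglotz

/-! ### Angular limits -/

section Angular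

variable {σ : ℂ}

theorem tendsto_angular_iff {α : Type*} {f : ℂ → α} {l : Filter α} :
    Tendsto f (angular σ) l ↔ ∀ M : ℝ, Tendsto f (𝓝[stolz σ M] σ) l :=
  tendsto_iSup

theorem angular_le_nhds (σ : ℂ) : angular σ ≤ 𝓝 σ :=
  iSup_le fun _ => nhdsWithin_le_nhds

theorem eventually_angular_mem_disk (σ : ℂ) : ∀ᶠ z in angular σ, z ∈ disk :=
  eventually_iSup.2 fun _ => eventually_mem_nhdsWithin.mono fun _ hz => mem_disk.2 hz.1

theorem angular_neBot (hσ : ‖σ‖ = 1) : (angular σ).NeBot := by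
  have hradial : Tendsto (fun r : ℝ => (r : ℂ) * σ) (𝓝[<] 1) (𝓝[stolz σ 2] σ) := by
    refine tendsto_nhdsWithin_iff.2 ⟨?_, ?_⟩
    · have hcont : Continuous fun r : ℝ => (r : ℂ) * σ := by fun_prop
      have hlim := (hcont.tendsto 1).mono_left (nhdsWithin_le_nhds (s := Iio 1))
      rwa [Complex.ofReal_one, one_mul] at hlim
    · filter_upwards [Ioo_mem_nhdsLT one_pos] with r ⟨hr0, hr1⟩
      have hnorm : ‖(r : ℂ) * σ‖ = r := by
        rw [norm_mul, hσ, mul_one, Complex.norm_real, Real.norm_of_nonneg hr0.le]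
      have hdist : ‖σ - (r : ℂ) * σ‖ = 1 - r := by
        rw [← one_sub_mul, norm_mul, hσ, mul_one, ← Complex.ofReal_one, ← Complex.ofReal_sub,
          Complex.norm_real, Real.norm_of_nonneg (sub_nonneg.2 hr1.le)]
      exact ⟨by rwa [hnorm], by rw [hnorm, hdist]; linarith⟩
  have hstolz : (𝓝[stolz σ 2] σ).NeBot := hradial.neBot
  exact hstolz.mono (le_iSup (fun M : ℝ => 𝓝[stolz σ M] σ) 2)

theorem pos_of_mem_stolz {M : ℝ} {z : ℂ} (hz : z ∈ stolz σ M) : 0 < M :=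
  pos_of_mul_pos_left ((norm_nonneg _).trans_lt hz.2) (sub_nonneg.2 hz.1.le)

theorem ne_of_mem_disk (hσ : ‖σ‖ = 1) {z : ℂ} (hz : z ∈ disk) : z ≠ σ := fun h =>
  (mem_disk.1 hz).ne (h ▸ hσ)

theorem sub_ne_zero_of_mem_disk (hσ : ‖σ‖ = 1) {z : ℂ} (hz : z ∈ disk) : σ - z ≠ 0 :=
  sub_ne_zero.2 (ne_of_mem_disk hσ hz).symm

theorem conj_mul_self_of_norm_eq_one (hσ : ‖σ‖ = 1) : conj σ * σ = 1 := by
  rw [Complex.conj_mul', hσ, Complex.ofReal_one, one_pow]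

theorem one_sub_conj_mul_eq (hσ : ‖σ‖ = 1) (z : ℂ) : 1 - conj σ * z = conj σ * (σ - z) := by
  rw [mul_sub, conj_mul_self_of_norm_eq_one hσ]

theorem norm_one_sub_conj_mul (hσ : ‖σ‖ = 1) (z : ℂ) : ‖1 - conj σ * z‖ = ‖σ - z‖ := by
  rw [one_sub_conj_mul_eq hσ, norm_mul, Complex.norm_conj, hσ, one_mul]

/-- The function on the disk whose superlevel sets are the pseudo-hyperbolic disks centred at `τ`
when `‖τ‖ < 1`, and the horodisks at `τ` when `‖τ‖ = 1`; in the second case it is the Poisson kernel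
at `τ`. It increases along every semigroup with Denjoy--Wolff point `τ`. -/
noncomputable def lyapunov (τ z : ℂ) : ℝ := (1 - ‖z‖ ^ 2) / ‖1 - conj τ * z‖ ^ 2

theorem lyapunov_pos {τ z : ℂ} (hτ : ‖τ‖ ≤ 1) (hz : z ∈ disk) : 0 < lyapunov τ z :=
  div_pos (one_sub_norm_sq_pos hz) (pow_pos (norm_pos_iff.2 (one_sub_conj_mul_ne_zero hz hτ)) 2)

/-- The Cayley map of the disk onto the right half-plane with pole at `σ`. It is Mathlib's
`herglotzRieszKernel 0 z σ`, seen as a function of `z`. -/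
noncomputable def cayley (σ z : ℂ) : ℂ := (σ + z) / (σ - z)

theorem re_cayley (hσ : ‖σ‖ = 1) (z : ℂ) : (cayley σ z).re = lyapunov σ z := by
  have hsq : ‖σ‖ ^ 2 = 1 := by rw [hσ, one_pow]
  rw [cayley, lyapunov, norm_one_sub_conj_mul hσ, Complex.div_re, ← add_div,
    Complex.normSq_eq_norm_sq, ← hsq]
  congr 1
  simp only [Complex.sq_norm, Complex.normSq_apply, Complex.add_re, Complex.sub_re,
    Complex.add_im, Complex.sub_im]
  ring

theorem isHerglotz_cayley (hσ : ‖σ‖ = 1) : IsHerglotz (cayley σ) where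
  holo := DifferentiableOn.div (by fun_prop) (by fun_prop) fun _ => sub_ne_zero_of_mem_disk hσ
  re_nonneg z hz := (lyapunov_pos hσ.le hz).le.trans_eq (re_cayley hσ z).symm

theorem continuousAt_cayley {z : ℂ} (h : z ≠ σ) : ContinuousAt (cayley σ) z :=
  ContinuousAt.div (by fun_prop) (by fun_prop) (sub_ne_zero.2 h.symm)

/-! ### The atom of a Herglotz function at a boundary point -/

namespace HasStar

variable {p q : ℂ → ℂ} {a b : ℂ}

theorem add (hp : HasStar p σ a) (hq : HasStar q σ b) :
    HasStar (fun z => p z + q z) σ (a + b) :=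
  (Tendsto.add hp hq).congr fun _ => (mul_add _ _ _).symm

theorem const_mul (hp : HasStar p σ a) (c : ℂ) : HasStar (fun z => c * p z) σ (c * a) :=
  (Tendsto.const_mul c hp).congr fun _ => mul_left_comm _ _ _

theorem unique (hσ : ‖σ‖ = 1) (ha : HasStar p σ a) (hb : HasStar p σ b) : a = b :=
  have := angular_neBot hσ
  tendsto_nhds_unique ha hb

end HasStar

theorem hasStar_cayley_self (hσ : ‖σ‖ = 1) : HasStar (cayley σ) σ 2 := by
  have hcont : Continuous fun z => conj σ * (σ + z) := by fun_prop
  have hlim := (hcont.tendsto σ).mono_left (angular_le_nhds σ)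
  rw [mul_add, conj_mul_self_of_norm_eq_one hσ, one_add_one_eq_two] at hlim
  refine hlim.congr' ?_
  filter_upwards [eventually_angular_mem_disk σ] with z hz
  rw [one_sub_conj_mul_eq hσ, cayley, mul_assoc,
    mul_div_cancel₀ _ (sub_ne_zero_of_mem_disk hσ hz)]

theorem hasStar_zero_of_continuousAt {p : ℂ → ℂ} (hσ : ‖σ‖ = 1) (hp : ContinuousAt p σ) :
    HasStar p σ 0 := by
  have hcont : ContinuousAt (fun z => (1 - conj σ * z) * p z) σ := by fun_prop
  have hlim := hcont.tendsto.mono_left (angular_le_nhds σ)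
  rwa [conj_mul_self_of_norm_eq_one hσ, sub_self, zero_mul] at hlim

namespace IsHerglotz

variable {p : ℂ → ℂ}

theorem norm_one_sub_conj_mul_le_of_mem_stolz (hp : IsHerglotz p) (hσ : ‖σ‖ = 1) {M : ℝ}
    {z w : ℂ} (hz : z ∈ stolz σ M) (hw : w ∈ disk) :
    ‖(1 - conj σ * z) * p z‖
      ≤ ‖σ - z‖ * ‖p w‖ + 4 * M * (p w).re * ‖1 - conj w * z‖ ^ 2 / (1 - ‖w‖ ^ 2) := by
  have hM := pos_of_mem_stolz hz
  have hw1 := one_sub_norm_sq_pos hw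
  have hstolz : ‖σ - z‖ ≤ M * (1 - ‖z‖ ^ 2) :=
    hz.2.le.trans (by gcongr; nlinarith [norm_nonneg z, hz.1])
  have hpick : (1 - ‖z‖ ^ 2) * ‖p z + conj (p w)‖
      ≤ 4 * (p w).re * ‖1 - conj w * z‖ ^ 2 / (1 - ‖w‖ ^ 2) := by
    rw [le_div_iff₀ hw1]
    linarith [hp.norm_add_conj_mul_le (mem_disk.2 hz.1) hw]
  have hpz : ‖p z‖ ≤ ‖p w‖ + ‖p z + conj (p w)‖ := by
    simpa [add_comm] using norm_sub_le (p z + conj (p w)) (conj (p w))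
  rw [norm_mul, norm_one_sub_conj_mul hσ]
  calc ‖σ - z‖ * ‖p z‖ ≤ ‖σ - z‖ * (‖p w‖ + ‖p z + conj (p w)‖) := by gcongr
    _ = ‖σ - z‖ * ‖p w‖ + ‖σ - z‖ * ‖p z + conj (p w)‖ := mul_add _ _ _
    _ ≤ ‖σ - z‖ * ‖p w‖ + M * (1 - ‖z‖ ^ 2) * ‖p z + conj (p w)‖ := by gcongr
    _ = ‖σ - z‖ * ‖p w‖ + M * ((1 - ‖z‖ ^ 2) * ‖p z + conj (p w)‖) := by ring
    _ ≤ ‖σ - z‖ * ‖p w‖ + M * (4 * (p w).re * ‖1 - conj w * z‖ ^ 2 / (1 - ‖w‖ ^ 2)) := by gcongr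
    _ = ‖σ - z‖ * ‖p w‖ + 4 * M * (p w).re * ‖1 - conj w * z‖ ^ 2 / (1 - ‖w‖ ^ 2) := by ring

theorem hasStar_zero (hp : IsHerglotz p) (hσ : ‖σ‖ = 1)
    (h : ∀ ε : ℝ, 0 < ε → ∃ w ∈ disk, (p w).re ≤ ε * lyapunov σ w) : HasStar p σ 0 := by
  refine tendsto_angular_iff.2 fun M => ?_
  refine NormedAddGroup.tendsto_nhds_zero.2 fun ε hε => ?_
  obtain ⟨w, hw, hpw⟩ := h (ε / (4 * (|M| + 1))) (by positivity)
  have hw1 := one_sub_norm_sq_pos hw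
  have hσw : 0 < ‖1 - conj σ * w‖ := norm_pos_iff.2 (one_sub_conj_mul_ne_zero hw hσ.le)
  have hswap : ‖1 - conj w * σ‖ = ‖1 - conj σ * w‖ := by
    rw [← Complex.norm_conj, map_sub, map_one, map_mul, Complex.conj_conj, mul_comm]
  have hpw' : (p w).re * ‖1 - conj σ * w‖ ^ 2 / (1 - ‖w‖ ^ 2) ≤ ε / (4 * (|M| + 1)) := by
    rwa [lyapunov, mul_div_assoc', le_div_iff₀ (by positivity), ← div_le_iff₀ hw1] at hpw
  have hlt : 4 * M * (p w).re * ‖1 - conj σ * w‖ ^ 2 / (1 - ‖w‖ ^ 2) < ε := by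
    have hnonneg : 0 ≤ (p w).re * ‖1 - conj σ * w‖ ^ 2 / (1 - ‖w‖ ^ 2) := by
      have := hp.re_nonneg w hw
      positivity
    calc 4 * M * (p w).re * ‖1 - conj σ * w‖ ^ 2 / (1 - ‖w‖ ^ 2)
        = 4 * M * ((p w).re * ‖1 - conj σ * w‖ ^ 2 / (1 - ‖w‖ ^ 2)) := by ring
      _ ≤ 4 * |M| * (ε / (4 * (|M| + 1))) := by gcongr; exact le_abs_self M
      _ = ε * (|M| / (|M| + 1)) := by field_simp
      _ < ε := mul_lt_of_lt_one_right hε ((div_lt_one (by positivity)).2 (lt_add_one _))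
  have hbound : Continuous fun z =>
      ‖σ - z‖ * ‖p w‖ + 4 * M * (p w).re * ‖1 - conj w * z‖ ^ 2 / (1 - ‖w‖ ^ 2) := by fun_prop
  have hlim := (hbound.tendsto σ).mono_left (nhdsWithin_le_nhds (s := stolz σ M))
  rw [sub_self, norm_zero, zero_mul, zero_add, hswap] at hlim
  filter_upwards [hlim.eventually_lt_const hlt, self_mem_nhdsWithin] with z hz hzM
  exact (hp.norm_one_sub_conj_mul_le_of_mem_stolz hσ hzM hw).trans_lt hz

theorem exists_star (hp : IsHerglotz p) (hσ : ‖σ‖ = 1) :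
    ∃ m : ℝ, 0 ≤ m ∧ IsHerglotz (fun z => p z - m * cayley σ z) ∧ HasStar p σ (2 * m) := by
  set S : Set ℝ := (fun z => (p z).re / lyapunov σ z) '' disk
  have hne : S.Nonempty := ⟨_, 0, zero_mem_disk, rfl⟩
  have hnonneg : ∀ x ∈ S, 0 ≤ x := by
    rintro _ ⟨z, hz, rfl⟩
    exact div_nonneg (hp.re_nonneg z hz) (lyapunov_pos hσ.le hz).le
  have hre : ∀ z, (p z - sInf S * cayley σ z).re = (p z).re - sInf S * lyapunov σ z := fun z => by
    rw [Complex.sub_re, Complex.re_ofReal_mul, re_cayley hσ]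
  have hrest : IsHerglotz (fun z => p z - sInf S * cayley σ z) := by
    refine ⟨hp.holo.sub ((isHerglotz_cayley hσ).holo.const_mul _), fun z hz => ?_⟩
    have hle : sInf S ≤ (p z).re / lyapunov σ z := csInf_le ⟨0, hnonneg⟩ ⟨z, hz, rfl⟩
    rw [hre]
    exact sub_nonneg.2 ((le_div_iff₀ (lyapunov_pos hσ.le hz)).1 hle)
  have hzero : HasStar (fun z => p z - sInf S * cayley σ z) σ 0 := by
    refine hrest.hasStar_zero hσ fun ε hε => ?_
    obtain ⟨_, ⟨w, hw, rfl⟩, hlt⟩ := exists_lt_of_csInf_lt hne (lt_add_of_pos_right (sInf S) hε)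
    refine ⟨w, hw, ?_⟩
    rw [div_lt_iff₀ (lyapunov_pos hσ.le hw)] at hlt
    rw [hre]
    linarith
  refine ⟨sInf S, le_csInf hne hnonneg, hrest, ?_⟩
  have hsum := hzero.add ((hasStar_cayley_self hσ).const_mul (sInf S : ℝ))
  simp only [sub_add_cancel, zero_add] at hsum
  rwa [mul_comm]

end IsHerglotz

end Angular

/-! ### Trajectories of holomorphic vector fields -/

theorem eq_mul_exp_integral {u h : ℝ → ℂ} {T : ℝ}
    (hu : ∀ t ∈ Icc 0 T, HasDerivWithinAt u (h t * u t) (Icc 0 T) t)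
    (hh : ContinuousOn h (Icc 0 T)) {t : ℝ} (ht : t ∈ Icc 0 T) :
    u t = u 0 * Complex.exp (∫ s in (0 : ℝ)..t, h s) := by
  have hprimitive : ∀ r ∈ Icc 0 T,
      HasDerivWithinAt (fun r => ∫ s in (0 : ℝ)..r, h s) (h r) (Icc 0 T) r := fun r hr =>
    haveI : Fact (r ∈ Icc 0 T) := ⟨hr⟩
    intervalIntegral.integral_hasDerivWithinAt_right
      ((hh.mono (Icc_subset_Icc_right hr.2)).intervalIntegrable_of_Icc hr.1)
      (hh.stronglyMeasurableAtFilter_nhdsWithin measurableSet_Icc r) (hh r hr)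
  have hquot : ∀ r ∈ Icc 0 T, HasDerivWithinAt
      (fun r => u r * Complex.exp (-∫ s in (0 : ℝ)..r, h s)) 0 (Icc 0 T) r := fun r hr => by
    refine ((hu r hr).mul (hprimitive r hr).neg.cexp).congr_deriv ?_
    ring
  have hconst := constant_of_has_deriv_right_zero
    (fun r hr => (hquot r hr).continuousWithinAt)
    (fun r hr => (hquot r (Ico_subset_Icc_self hr)).mono_of_mem_nhdsWithin
      (Icc_mem_nhdsGE_of_mem hr)) t ht
  simp only [intervalIntegral.integral_same, neg_zero, Complex.exp_zero, mul_one] at hconst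
  rw [← hconst, mul_assoc, ← Complex.exp_add, neg_add_cancel, Complex.exp_zero, mul_one]

theorem norm_exp_integral_le {h : ℝ → ℂ} {C t : ℝ} (ht : 0 ≤ t)
    (hC : ∀ s ∈ Icc 0 t, ‖h s‖ ≤ C) :
    ‖Complex.exp (∫ s in (0 : ℝ)..t, h s)‖ ≤ Real.exp (C * t) := by
  refine (Complex.norm_exp_le_exp_norm _).trans (Real.exp_le_exp.2 ?_)
  have hint := intervalIntegral.norm_integral_le_of_norm_le_const (a := 0) (b := t) (f := h)
    fun s hs => hC s (Ioc_subset_Icc_self (uIoc_of_le ht ▸ hs))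
  rwa [sub_zero, abs_of_nonneg ht] at hint

theorem lt_of_forall_le_imp_lt {f : ℝ → ℝ} {T B : ℝ} (hf : ContinuousOn f (Icc 0 T))
    (h0 : f 0 < B) (h : ∀ s ∈ Icc 0 T, (∀ r ∈ Icc 0 s, f r ≤ B) → f s < B) :
    ∀ s ∈ Icc 0 T, f s < B := by
  by_contra! ⟨s₀, hs₀, hfs₀⟩
  have hcompact : IsCompact (Icc 0 T ∩ f ⁻¹' Ici B) :=
    isCompact_Icc.of_isClosed_subset (hf.preimage_isClosed_of_isClosed isClosed_Icc isClosed_Ici)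
      inter_subset_left
  obtain ⟨s, ⟨hs, hfs⟩, hleast⟩ := hcompact.exists_isLeast ⟨s₀, hs₀, hfs₀⟩
  have hne : 0 ≠ s := fun hs0 => h0.not_ge (hs0 ▸ hfs)
  have hbefore : ∀ r ∈ Ico 0 s, f r ≤ B := fun r hr => by
    by_contra! hBr
    exact hr.2.not_ge (hleast ⟨⟨hr.1, hr.2.le.trans hs.2⟩, hBr.le⟩)
  refine (h s hs fun r hr => ?_).not_ge hfs
  rw [← closure_Ico hne] at hr
  refine le_on_closure hbefore ?_ continuousOn_const hr
  rw [closure_Ico hne]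
  exact hf.mono (Icc_subset_Icc_right hs.2)

section DSlope

variable {𝕜 E : Type*} [RCLike 𝕜] [NormedAddCommGroup E] [NormedSpace 𝕜 E] {f : 𝕜 → E} {a b : 𝕜}

theorem continuousAt_uncurry_dslope_of_ne (hab : a ≠ b) (ha : ContinuousAt f a)
    (hb : ContinuousAt f b) : ContinuousAt (fun x : 𝕜 × 𝕜 => dslope f x.1 x.2) (a, b) := by
  have hslope : ContinuousAt (fun x : 𝕜 × 𝕜 => (x.2 - x.1)⁻¹ • (f x.2 - f x.1)) (a, b) :=
    ContinuousAt.smul (ContinuousAt.inv₀ (by fun_prop) (sub_ne_zero.2 hab.symm))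
      ((hb.comp' continuousAt_snd).sub (ha.comp' continuousAt_fst))
  refine hslope.congr ?_
  filter_upwards [(isOpen_ne_fun continuous_snd continuous_fst).mem_nhds hab.symm] with x hx
  rw [dslope_of_ne _ hx, slope_def_module]

theorem continuousAt_uncurry_dslope_self [CompleteSpace E] (ha : AnalyticAt 𝕜 f a) :
    ContinuousAt (fun x : 𝕜 × 𝕜 => dslope f x.1 x.2) (a, a) := by
  rw [ContinuousAt, dslope_same, Metric.tendsto_nhds]
  intro ε hε
  have hstrict := ha.hasStrictDerivAt.hasStrictFDerivAt.isLittleO.def (half_pos hε)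
  have hderiv : ∀ᶠ x : 𝕜 × 𝕜 in 𝓝 (a, a), dist (deriv f x.1) (deriv f a) < ε :=
    Metric.tendsto_nhds.1 (ha.deriv.continuousAt.comp' (x := (a, a)) continuousAt_fst) ε hε
  filter_upwards [hstrict, hderiv] with x hslope hdiag
  rcases eq_or_ne x.1 x.2 with heq | hne
  · rwa [← heq, dslope_same]
  · have hsub : x.1 - x.2 ≠ 0 := sub_ne_zero.2 hne
    have hpos : 0 < ‖x.1 - x.2‖ := norm_pos_iff.2 hsub
    rw [ContinuousLinearMap.toSpanSingleton_apply] at hslope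
    have hquot : slope f x.2 x.1 - deriv f a
        = (x.1 - x.2)⁻¹ • (f x.1 - f x.2 - (x.1 - x.2) • deriv f a) := by
      rw [smul_sub, inv_smul_smul₀ hsub, slope_def_module]
    rw [dslope_of_ne _ hne.symm, slope_comm, dist_eq_norm, hquot, norm_smul, norm_inv,
      inv_mul_lt_iff₀ hpos]
    nlinarith

end DSlope

theorem continuousOn_uncurry_dslope {G : ℂ → ℂ} {s : Set ℂ} (hs : IsOpen s)
    (hG : DifferentiableOn ℂ G s) :
    ContinuousOn (fun x : ℂ × ℂ => dslope G x.1 x.2) (s ×ˢ s) := by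
  rintro ⟨a, b⟩ ⟨ha, hb⟩
  refine ContinuousAt.continuousWithinAt ?_
  have hcont : ∀ c ∈ s, ContinuousAt G c := fun c hc =>
    (hG.differentiableAt (hs.mem_nhds hc)).continuousAt
  rcases eq_or_ne a b with rfl | hab
  · exact continuousAt_uncurry_dslope_self (hG.analyticAt (hs.mem_nhds ha))
  · exact continuousAt_uncurry_dslope_of_ne hab (hcont a ha) (hcont b hb)

/-- The curve `γ` is a trajectory of the vector field `G` which stays in the disk during the time
interval `[0, T]`. -/
def IsTrajectory (G : ℂ → ℂ) (T : ℝ) (γ : ℝ → ℂ) : Prop :=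
  ∀ t ∈ Icc 0 T, γ t ∈ disk ∧ HasDerivWithinAt γ (G (γ t)) (Icc 0 T) t

namespace IsTrajectory

variable {G : ℂ → ℂ} {T : ℝ} {γ δ : ℝ → ℂ}

theorem continuousOn (hγ : IsTrajectory G T γ) : ContinuousOn γ (Icc 0 T) := fun t ht =>
  (hγ t ht).2.continuousWithinAt

theorem mapsTo (hγ : IsTrajectory G T γ) : MapsTo γ (Icc 0 T) disk := fun t ht => (hγ t ht).1

theorem mono (hγ : IsTrajectory G T γ) {S : ℝ} (hS : S ≤ T) : IsTrajectory G S γ := fun t ht =>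
  have hsub := Icc_subset_Icc_right hS
  ⟨(hγ t (hsub ht)).1, (hγ t (hsub ht)).2.mono hsub⟩

theorem congr (hγ : IsTrajectory G T γ) (h : EqOn δ γ (Icc 0 T)) : IsTrajectory G T δ :=
  fun t ht => by
    rw [h ht]
    exact ⟨(hγ t ht).1, (hγ t ht).2.congr h (h ht)⟩

theorem continuousOn_dslope (hG : DifferentiableOn ℂ G disk) (hγ : IsTrajectory G T γ)
    (hδ : IsTrajectory G T δ) : ContinuousOn (fun s => dslope G (δ s) (γ s)) (Icc 0 T) :=
  ContinuousOn.comp (g := fun x : ℂ × ℂ => dslope G x.1 x.2) (f := fun s => (δ s, γ s))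
    (continuousOn_uncurry_dslope isOpen_disk hG) (hδ.continuousOn.prodMk hγ.continuousOn)
    fun _ hs => mk_mem_prod (hδ.mapsTo hs) (hγ.mapsTo hs)

theorem sub_eq (hG : DifferentiableOn ℂ G disk) (hγ : IsTrajectory G T γ)
    (hδ : IsTrajectory G T δ) {t : ℝ} (ht : t ∈ Icc 0 T) :
    γ t - δ t = (γ 0 - δ 0) * Complex.exp (∫ s in (0 : ℝ)..t, dslope G (δ s) (γ s)) := by
  refine eq_mul_exp_integral (u := fun s => γ s - δ s) (fun s hs => ?_)
    (hγ.continuousOn_dslope hG hδ) ht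
  refine ((hγ s hs).2.sub (hδ s hs).2).congr_deriv ?_
  rw [mul_comm, ← smul_eq_mul, sub_smul_dslope]

theorem eqOn (hG : DifferentiableOn ℂ G disk) (hγ : IsTrajectory G T γ)
    (hδ : IsTrajectory G T δ) (h0 : γ 0 = δ 0) : EqOn γ δ (Icc 0 T) := fun t ht => by
  rw [← sub_eq_zero, hγ.sub_eq hG hδ ht, h0, sub_self, zero_mul]

theorem hasDerivWithinAt_one_sub_norm_sq (hγ : IsTrajectory G T γ) {t : ℝ} (ht : t ∈ Icc 0 T) :
    HasDerivWithinAt (fun s => 1 - ‖γ s‖ ^ 2) (-(2 * (conj (γ t) * G (γ t)).re)) (Icc 0 T) t := by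
  have hder := (hγ t ht).2.norm_sq.const_sub 1
  rwa [Complex.inner, mul_comm (G _)] at hder

end IsTrajectory

/-- A bound on the outward radial component of the vector field `G` near the unit circle. It keeps
the trajectories of `G` away from the circle in bounded time. -/
def RadiallyBounded (G : ℂ → ℂ) (C : ℝ) : Prop :=
  ∀ z ∈ disk, (conj z * G z).re ≤ C * (1 - ‖z‖ ^ 2)

namespace RadiallyBounded

variable {G : ℂ → ℂ} {C T : ℝ}

theorem nonneg (hC : RadiallyBounded G C) : 0 ≤ C := by
  simpa using hC 0 zero_mem_disk

theorem one_sub_norm_sq_mul_exp_le (hC : RadiallyBounded G C) {γ : ℝ → ℂ}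
    (hγ : IsTrajectory G T γ) {t : ℝ} (ht : t ∈ Icc 0 T) :
    (1 - ‖γ 0‖ ^ 2) * Real.exp (-(2 * C * t)) ≤ 1 - ‖γ t‖ ^ 2 := by
  have hder : ∀ s ∈ Icc 0 T, HasDerivWithinAt
      (fun s => (1 - ‖γ s‖ ^ 2) * Real.exp (2 * C * s))
      (2 * (C * (1 - ‖γ s‖ ^ 2) - (conj (γ s) * G (γ s)).re) * Real.exp (2 * C * s))
      (Icc 0 T) s := fun s hs => by
    have hexp := ((hasDerivAt_id s).const_mul (2 * C)).exp.hasDerivWithinAt (s := Icc 0 T)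
    refine ((hγ.hasDerivWithinAt_one_sub_norm_sq hs).mul hexp).congr_deriv ?_
    simp only [id]
    ring
  have hmono : MonotoneOn (fun s => (1 - ‖γ s‖ ^ 2) * Real.exp (2 * C * s)) (Icc 0 T) :=
    monotoneOn_of_hasDerivWithinAt_nonneg (convex_Icc 0 T)
      (fun s hs => (hder s hs).continuousWithinAt)
      (fun s hs => (hder s (interior_subset hs)).mono interior_subset) fun s hs =>
      mul_nonneg (mul_nonneg two_pos.le
        (sub_nonneg.2 (hC _ (hγ.mapsTo (interior_subset hs))))) (Real.exp_pos _).le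
  have hle := hmono ⟨le_rfl, ht.1.trans ht.2⟩ ht ht.1
  simp only [mul_zero, Real.exp_zero, mul_one] at hle
  rwa [Real.exp_neg, ← div_eq_mul_inv, div_le_iff₀ (Real.exp_pos _)]

theorem exists_radius (hC : RadiallyBounded G C) {r : ℝ} (hr0 : 0 ≤ r) (hr1 : r < 1)
    (hT : 0 ≤ T) : ∃ R, r < R ∧ R < 1 ∧ ∀ S γ, S ≤ T → IsTrajectory G S γ → ‖γ 0‖ ≤ r →
      ∀ t ∈ Icc 0 S, ‖γ t‖ < R := by
  set η := (1 - r ^ 2) * Real.exp (-(2 * C * T)) with hη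
  have hr : 0 < 1 - r ^ 2 := by nlinarith
  have hη0 : 0 < η := mul_pos hr (Real.exp_pos _)
  have hη1 : η ≤ 1 - r ^ 2 := mul_le_of_le_one_right hr.le
    (Real.exp_le_one_iff.2 (neg_nonpos.2 (mul_nonneg (mul_nonneg two_pos.le hC.nonneg) hT)))
  refine ⟨√(1 - η / 2), (Real.lt_sqrt hr0).2 (by linarith),
    (Real.sqrt_lt' one_pos).2 (by linarith), fun S γ hS hγ h0 t ht => ?_⟩
  have hle : η ≤ 1 - ‖γ t‖ ^ 2 := calc
    η ≤ (1 - ‖γ 0‖ ^ 2) * Real.exp (-(2 * C * t)) := by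
        have := hC.nonneg
        rw [hη]
        gcongr
        · nlinarith [norm_nonneg (γ 0)]
        · exact ht.2.trans hS
    _ ≤ 1 - ‖γ t‖ ^ 2 := hC.one_sub_norm_sq_mul_exp_le hγ ht
  exact (Real.lt_sqrt (norm_nonneg _)).2 (by linarith)

end RadiallyBounded

section LipschitzCutoff

variable {E F : Type*} [NormedAddCommGroup E] [NormedSpace ℝ E] [FiniteDimensional ℝ E]
  [NormedAddCommGroup F] [NormedSpace ℝ F]

theorem exists_lipschitzWith_bounded_eqOn_closedBall {f : E → F} {c : E} {r R : ℝ} (hr : 0 < r)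
    (hrR : r < R) (hf : ContDiffOn ℝ 1 f (ball c R)) :
    ∃ g : E → F, (∃ K, LipschitzWith K g) ∧ (∃ C, ∀ x, ‖g x‖ ≤ C) ∧ EqOn g f (closedBall c r) := by
  let χ : ContDiffBump c := ⟨r, (r + R) / 2, hr, by linarith⟩
  have hsupp : HasCompactSupport fun x => χ x • f x := χ.hasCompactSupport.smul_right
  have hsmooth : ContDiff ℝ 1 fun x => χ x • f x := by
    refine contMDiff_iff_contDiff.1 (contMDiff_of_tsupport fun x hx => ?_)
    have hxχ := tsupport_smul_subset_left _ _ hx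
    rw [χ.tsupport_eq] at hxχ
    have hxR : x ∈ ball c R := closedBall_subset_ball (show (r + R) / 2 < R by linarith) hxχ
    exact (χ.contDiffAt.smul (hf.contDiffAt (isOpen_ball.mem_nhds hxR))).contMDiffAt
  refine ⟨fun x => χ x • f x, hsmooth.lipschitzWith_of_hasCompactSupport hsupp one_ne_zero,
    hsmooth.continuous.bounded_above_of_compact_support hsupp, fun x hx => ?_⟩
  simp only [χ.one_of_mem_closedBall hx, one_smul]

end LipschitzCutoff

theorem exists_hasDerivWithinAt_Icc_of_lipschitzWith {E : Type*} [NormedAddCommGroup E]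
    [NormedSpace ℝ E] [CompleteSpace E] {F : E → E} {K : NNReal} (hK : LipschitzWith K F) {C : ℝ}
    (hC : ∀ x, ‖F x‖ ≤ C) (x : E) {T : ℝ} (hT : 0 ≤ T) :
    ∃ γ : ℝ → E, γ 0 = x ∧ ∀ t ∈ Icc 0 T, HasDerivWithinAt γ (F (γ t)) (Icc 0 T) t := by
  have hC0 : 0 ≤ C := (norm_nonneg _).trans (hC x)
  have hPL : IsPicardLindelof (fun _ => F) (⟨0, le_rfl, hT⟩ : Icc 0 T) x
      (C.toNNReal * T.toNNReal) 0 C.toNNReal K := by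
    refine IsPicardLindelof.of_time_independent (fun y _ => ?_) hK.lipschitzOnWith ?_
    · rw [Real.coe_toNNReal _ hC0]
      exact hC y
    · simp [Real.coe_toNNReal _ hC0, hT]
  exact hPL.exists_eq_forall_mem_Icc_hasDerivWithinAt₀

theorem RadiallyBounded.exists_trajectory {G : ℂ → ℂ} {C : ℝ} (hC : RadiallyBounded G C)
    (hG : DifferentiableOn ℂ G disk) {z : ℂ} (hz : z ∈ disk) {T : ℝ} (hT : 0 ≤ T) :
    ∃ γ : ℝ → ℂ, γ 0 = z ∧ IsTrajectory G T γ := by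
  obtain ⟨R, hzR, hR1, hR⟩ := hC.exists_radius (norm_nonneg z) (mem_disk.1 hz) hT
  obtain ⟨F, ⟨K, hK⟩, ⟨B, hB⟩, hFG⟩ := exists_lipschitzWith_bounded_eqOn_closedBall
    ((norm_nonneg z).trans_lt hzR) hR1 ((hG.contDiffOn isOpen_disk).restrict_scalars ℝ)
  obtain ⟨γ, h0, hγ⟩ := exists_hasDerivWithinAt_Icc_of_lipschitzWith hK hB z hT
  have htraj : ∀ s ∈ Icc 0 T, (∀ r ∈ Icc 0 s, ‖γ r‖ ≤ R) → IsTrajectory G s γ := by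
    intro s hs hle r hr
    have hsub : Icc 0 s ⊆ Icc 0 T := Icc_subset_Icc_right hs.2
    refine ⟨mem_disk.2 ((hle r hr).trans_lt hR1), ?_⟩
    rw [← hFG (mem_closedBall_zero_iff.2 (hle r hr))]
    exact (hγ r (hsub hr)).mono hsub
  -- `γ` solves the equation of `G`, hence obeys the bound by `R`, as long as it has not left
  -- `closedBall 0 R`: so it never leaves.
  have hstay : ∀ s ∈ Icc 0 T, ‖γ s‖ < R := by
    have hcont : ContinuousOn γ (Icc 0 T) := fun s hs => (hγ s hs).continuousWithinAt
    exact lt_of_forall_le_imp_lt hcont.norm (h0 ▸ hzR) fun s hs hle =>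
      hR s γ hs.2 (htraj s hs hle) (h0 ▸ le_rfl) s ⟨hs.1, le_rfl⟩
  exact ⟨γ, h0, htraj T ⟨hT, le_rfl⟩ fun r hr => (hstay r hr).le⟩

/-! ### The semigroup generated by a radially bounded vector field -/

theorem IsTrajectory.shift {G : ℂ → ℂ} {S t : ℝ} {γ : ℝ → ℂ} (hγ : IsTrajectory G (S + t) γ)
    (ht : 0 ≤ t) : IsTrajectory G S fun r => γ (r + t) := fun r hr => by
  have hmaps : MapsTo (· + t) (Icc 0 S) (Icc 0 (S + t)) := fun q hq =>
    ⟨add_nonneg hq.1 ht, add_le_add_left hq.2 t⟩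
  refine ⟨hγ.mapsTo (hmaps hr), ?_⟩
  have hder := (hγ (r + t) (hmaps hr)).2.scomp r
    ((hasDerivAt_id r).add_const t).hasDerivWithinAt hmaps
  rwa [one_smul] at hder

section Flow

variable {G : ℂ → ℂ} {φ : ℝ → ℂ → ℂ} {t : ℝ}

theorem RadiallyBounded.exists_compact_flow_mem {C : ℝ} (hC : RadiallyBounded G C) (ht : 0 ≤ t)
    (hφ0 : ∀ z ∈ disk, φ 0 z = z) (hφ : ∀ z ∈ disk, IsTrajectory G t fun s => φ s z) {z : ℂ}
    (hz : z ∈ disk) :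
    ∃ K ⊆ disk, IsCompact K ∧ ∀ᶠ w in 𝓝 z, ∀ s ∈ Icc 0 t, φ s w ∈ K := by
  obtain ⟨r, hzr, hr1⟩ := exists_between (mem_disk.1 hz)
  obtain ⟨R, -, hR1, hR⟩ := hC.exists_radius ((norm_nonneg z).trans hzr.le) hr1 ht
  refine ⟨closedBall 0 R, closedBall_subset_ball hR1, isCompact_closedBall 0 R, ?_⟩
  filter_upwards [continuous_norm.continuousAt.eventually_lt_const hzr, disk_mem_nhds hz]
    with w hw hwd s hs
  rw [mem_closedBall_zero_iff]
  exact (hR t _ le_rfl (hφ w hwd) (by rw [hφ0 w hwd]; exact hw.le) s hs).le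

variable {z : ℂ} {K : Set ℂ} (hG : DifferentiableOn ℂ G disk) (hφ0 : ∀ z ∈ disk, φ 0 z = z)
  (hφ : ∀ z ∈ disk, IsTrajectory G t fun s => φ s z) (hz : z ∈ disk) (hK : IsCompact K)
  (hKd : K ⊆ disk) (hstay : ∀ᶠ w in 𝓝 z, ∀ s ∈ Icc 0 t, φ s w ∈ K)

include hG hφ0 hφ hz hK hKd hstay

theorem tendstoUniformlyOn_flow :
    TendstoUniformlyOn (fun w s => φ s w) (fun s => φ s z) (𝓝 z) (Icc 0 t) := by
  obtain ⟨B, hB⟩ := (hK.prod hK).exists_bound_of_continuousOn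
    ((continuousOn_uncurry_dslope isOpen_disk hG).mono (prod_mono hKd hKd))
  have hlip : ∀ᶠ w in 𝓝 z, ∀ s ∈ Icc 0 t, ‖φ s w - φ s z‖ ≤ ‖w - z‖ * Real.exp (|B| * t) := by
    filter_upwards [hstay, disk_mem_nhds hz] with w hwK hw s hs
    have hbound : ∀ r ∈ Icc 0 s, ‖dslope G (φ r z) (φ r w)‖ ≤ |B| := fun r hr =>
      have hrt := Icc_subset_Icc_right hs.2 hr
      (hB (φ r z, φ r w) ⟨hstay.self_of_nhds r hrt, hwK r hrt⟩).trans (le_abs_self B)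
    rw [(hφ w hw).sub_eq hG (hφ z hz) hs, hφ0 w hw, hφ0 z hz, norm_mul]
    gcongr
    refine (norm_exp_integral_le hs.1 hbound).trans ?_
    gcongr
    exact hs.2
  have hlim : Tendsto (fun w => ‖w - z‖ * Real.exp (|B| * t)) (𝓝 z) (𝓝 0) :=
    Continuous.tendsto' (by fun_prop) _ _ (by simp)
  rw [Metric.tendstoUniformlyOn_iff]
  intro ε hε
  filter_upwards [hlip, hlim.eventually_lt_const hε] with w hw hwε s hs
  rw [dist_comm, dist_eq_norm]
  exact (hw s hs).trans_lt hwε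

theorem hasDerivAt_flow (ht : 0 ≤ t) :
    HasDerivAt (φ t) (Complex.exp (∫ s in (0 : ℝ)..t, deriv G (φ s z))) z := by
  have hunif : TendstoUniformlyOn (fun w s => dslope G (φ s z) (φ s w))
      (fun s => dslope G (φ s z) (φ s z)) (𝓝 z) (Icc 0 t) := by
    have huc := (hK.prod hK).uniformContinuousOn_of_continuous
      ((continuousOn_uncurry_dslope isOpen_disk hG).mono (prod_mono hKd hKd))
    have hflow := tendstoUniformlyOn_flow hG hφ0 hφ hz hK hKd hstay
    have hconst : TendstoUniformlyOn (fun (_ : ℂ) s => φ s z) (fun s => φ s z) (𝓝 z) (Icc 0 t) :=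
      fun u hu => Eventually.of_forall fun _ _ _ => refl_mem_uniformity hu
    have hpair : TendstoUniformlyOn (fun w s => (φ s z, φ s w)) (fun s => (φ s z, φ s z)) (𝓝 z)
        (Icc 0 t) :=
      fun u hu => ((hconst.prodMk hflow) u hu).diag_of_prod
    exact UniformContinuousOn.comp_tendstoUniformlyOn_eventually
      (F := fun w s => (φ s z, φ s w)) (f := fun s => (φ s z, φ s z)) (s := K ×ˢ K)
      (hstay.mono fun w hw s hs => ⟨hstay.self_of_nhds s hs, hw s hs⟩)
      (fun s hs => ⟨hstay.self_of_nhds s hs, hstay.self_of_nhds s hs⟩) huc hpair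
  have hlim : Tendsto (fun w => ∫ s in (0 : ℝ)..t, dslope G (φ s z) (φ s w)) (𝓝 z)
      (𝓝 (∫ s in (0 : ℝ)..t, dslope G (φ s z) (φ s z))) := by
    rw [← uIcc_of_le ht] at hunif
    refine hunif.tendsto_intervalIntegral_of_continuousOn ?_
    filter_upwards [disk_mem_nhds hz] with w hw
    rw [uIcc_of_le ht]
    exact (hφ w hw).continuousOn_dslope hG (hφ z hz)
  simp only [dslope_same] at hlim
  rw [hasDerivAt_iff_tendsto_slope]
  refine (hlim.cexp.mono_left nhdsWithin_le_nhds).congr' ?_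
  filter_upwards [nhdsWithin_le_nhds (disk_mem_nhds hz), self_mem_nhdsWithin] with w hw hwz
  rw [slope_def_field, (hφ w hw).sub_eq hG (hφ z hz) ⟨ht, le_rfl⟩, hφ0 w hw, hφ0 z hz,
    mul_div_cancel_left₀ _ (sub_ne_zero.2 hwz)]

end Flow

namespace RadiallyBounded

variable {G : ℂ → ℂ} {C : ℝ}

theorem exists_flow (hC : RadiallyBounded G C) (hG : DifferentiableOn ℂ G disk) :
    ∃ φ : ℝ → ℂ → ℂ,
      (∀ z ∈ disk, φ 0 z = z) ∧ ∀ z ∈ disk, ∀ T, IsTrajectory G T fun t => φ t z := by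
  choose! Γ hΓ0 hΓ using fun z (hz : z ∈ disk) T (hT : 0 ≤ T) => hC.exists_trajectory hG hz hT
  refine ⟨fun t z => Γ z t t, fun z hz => hΓ0 z hz 0 le_rfl, fun z hz T => ?_⟩
  rcases lt_or_ge T 0 with hT | hT
  · exact fun t ht => absurd (ht.1.trans ht.2) hT.not_ge
  · refine (hΓ z hz T hT).congr fun t ht => ?_
    exact (hΓ z hz t ht.1).eqOn hG ((hΓ z hz T hT).mono ht.2)
      ((hΓ0 z hz t ht.1).trans (hΓ0 z hz T hT).symm) ⟨ht.1, le_rfl⟩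

theorem exists_isGeneratorOf (hC : RadiallyBounded G C) (hG : DifferentiableOn ℂ G disk) :
    ∃ φ, IsGeneratorOf G φ := by
  obtain ⟨φ, hφ0, hφ⟩ := hC.exists_flow hG
  have hmaps : ∀ t, 0 ≤ t → MapsTo (φ t) disk disk := fun t ht z hz =>
    (hφ z hz t).mapsTo ⟨ht, le_rfl⟩
  have hflow : ∀ z ∈ disk, ∀ t, 0 ≤ t →
      HasDerivWithinAt (fun s => φ s z) (G (φ t z)) (Ici 0) t := fun z hz t ht => by
    refine (hφ z hz (t + 1) t ⟨ht, by linarith⟩).2.mono_of_mem_nhdsWithin ?_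
    rw [← Ici_inter_Iic]
    exact inter_mem self_mem_nhdsWithin (nhdsWithin_le_nhds (Iic_mem_nhds (by linarith)))
  refine ⟨φ, ⟨fun t ht z hz => ?_, hmaps, hφ0, fun s t hs ht z hz => ?_, fun z hz => ?_⟩, hG, hflow⟩
  · obtain ⟨K, hKd, hK, hstay⟩ := hC.exists_compact_flow_mem ht hφ0 (fun w hw => hφ w hw t) hz
    exact (hasDerivAt_flow hG hφ0 (fun w hw => hφ w hw t) hz hK hKd hstay
      ht).differentiableAt.differentiableWithinAt
  · have hshift : IsTrajectory G s fun r => φ (r + t) z := (hφ z hz (s + t)).shift ht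
    refine hshift.eqOn hG (hφ _ (hmaps t ht hz) s) ?_ ⟨hs, le_rfl⟩
    simp only [zero_add, hφ0 _ (hmaps t ht hz)]
  · have hcont := (hflow z hz 0 le_rfl).continuousWithinAt.tendsto
    simp only [hφ0 z hz] at hcont
    exact hcont.mono_left (nhdsWithin_mono _ Ioi_subset_Ici_self)

end RadiallyBounded

/-! ### Boundary regular fixed points of the semigroup -/

theorem one_sub_norm_mul_le {f : ℂ → ℂ} (hf : DifferentiableOn ℂ f disk)
    (hmaps : MapsTo f disk disk) {z : ℂ} (hz : z ∈ disk) :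
    (1 - ‖z‖) * (1 - ‖f 0‖) ^ 2 ≤ 2 * (1 - ‖f z‖) := by
  have hpick := one_sub_norm_sq_mul_le hf hmaps hz zero_mem_disk
  simp only [norm_zero, map_zero, zero_mul, sub_zero, norm_one, ne_eq, OfNat.ofNat_ne_zero,
    not_false_eq_true, zero_pow, one_pow, mul_one] at hpick
  have hz1 := mem_disk.1 hz
  have hfz := mem_disk.1 (hmaps hz)
  have hf0 := mem_disk.1 (hmaps zero_mem_disk)
  have hlow : 1 - ‖f 0‖ ≤ ‖1 - conj (f 0) * f z‖ := calc
    1 - ‖f 0‖ ≤ ‖(1 : ℂ)‖ - ‖conj (f 0) * f z‖ := by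
        rw [norm_one, norm_mul, Complex.norm_conj]
        gcongr
        exact mul_le_of_le_one_right (norm_nonneg _) hfz.le
    _ ≤ ‖1 - conj (f 0) * f z‖ := norm_sub_norm_le _ _
  calc (1 - ‖z‖) * (1 - ‖f 0‖) ^ 2
      ≤ (1 - ‖z‖ ^ 2) * ‖1 - conj (f 0) * f z‖ ^ 2 := by
        gcongr
        · exact (one_sub_norm_sq_pos hz).le
        · nlinarith [norm_nonneg z]
    _ ≤ (1 - ‖f z‖ ^ 2) * (1 - ‖f 0‖ ^ 2) := hpick
    _ ≤ (1 - ‖f z‖ ^ 2) * 1 := by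
        gcongr
        · exact (one_sub_norm_sq_pos (hmaps hz)).le
        · exact sub_le_self _ (sq_nonneg _)
    _ ≤ 2 * (1 - ‖f z‖) := by nlinarith [sq_nonneg (1 - ‖f z‖)]

namespace IsGeneratorOf

variable {G : ℂ → ℂ} {φ : ℝ → ℂ → ℂ} {σ c z : ℂ} {t : ℝ}

theorem isTrajectory (h : IsGeneratorOf G φ) (hz : z ∈ disk) (T : ℝ) :
    IsTrajectory G T fun t => φ t z :=
  fun t ht => ⟨h.semigroup.mapsTo t ht.1 hz, (h.flow z hz t ht.1).mono Icc_subset_Ici_self⟩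

theorem continuousOn_div_sub (h : IsGeneratorOf G φ) (hσ : ‖σ‖ = 1) (hz : z ∈ disk) (t : ℝ) :
    ContinuousOn (fun s => G (φ s z) / (φ s z - σ)) (Icc 0 t) :=
  have htraj := h.isTrajectory hz t
  (h.holo.continuousOn.comp htraj.continuousOn htraj.mapsTo).div
    (htraj.continuousOn.sub continuousOn_const) fun _ hs =>
      sub_ne_zero.2 (ne_of_mem_disk hσ (htraj.mapsTo hs))

theorem sub_eq (h : IsGeneratorOf G φ) (hσ : ‖σ‖ = 1) (hz : z ∈ disk) (ht : 0 ≤ t) :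
    φ t z - σ = (z - σ) * Complex.exp (∫ s in (0 : ℝ)..t, G (φ s z) / (φ s z - σ)) := by
  have htraj := h.isTrajectory hz t
  have hexp := eq_mul_exp_integral (u := fun s => φ s z - σ)
    (fun s hs => ((htraj s hs).2.sub_const σ).congr_deriv
      (div_mul_cancel₀ _ (sub_ne_zero.2 (ne_of_mem_disk hσ (htraj.mapsTo hs)))).symm)
    (h.continuousOn_div_sub hσ hz t) ⟨ht, le_rfl⟩
  simpa only [h.semigroup.zero z hz] using hexp

theorem exists_one_sub_norm_le (h : IsGeneratorOf G φ) (ht : 0 ≤ t) : ∃ K : ℝ, 0 < K ∧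
    ∀ s ∈ Icc 0 t, ∀ z ∈ disk, 1 - ‖z‖ ≤ K * (1 - ‖φ s z‖) := by
  have htraj := h.isTrajectory zero_mem_disk t
  obtain ⟨s₀, hs₀, hmax⟩ := isCompact_Icc.exists_isMaxOn ⟨0, le_rfl, ht⟩ htraj.continuousOn.norm
  have hpos : 0 < 1 - ‖φ s₀ 0‖ := sub_pos.2 (mem_disk.1 (htraj.mapsTo hs₀))
  refine ⟨2 / (1 - ‖φ s₀ 0‖) ^ 2, by positivity, fun s hs z hz => ?_⟩
  have hz1 : 0 ≤ 1 - ‖z‖ := sub_nonneg.2 (mem_disk.1 hz).le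
  rw [div_mul_eq_mul_div, le_div_iff₀ (by positivity)]
  calc (1 - ‖z‖) * (1 - ‖φ s₀ 0‖) ^ 2 ≤ (1 - ‖z‖) * (1 - ‖φ s 0‖) ^ 2 := by
        gcongr
        exact hmax hs
    _ ≤ 2 * (1 - ‖φ s z‖) :=
        one_sub_norm_mul_le (h.semigroup.holo s hs.1) (h.semigroup.mapsTo s hs.1) hz

theorem eventually_mem_of_norm_sub_le (h : IsGeneratorOf G φ) (ht : 0 ≤ t) {U : Set ℂ}
    (hU : U ∈ angular σ) (E M : ℝ) :
    ∀ᶠ z in 𝓝[stolz σ M] σ, ∀ s ∈ Icc 0 t, ‖φ s z - σ‖ ≤ E * ‖z - σ‖ → φ s z ∈ U := by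
  obtain ⟨K, _, hK⟩ := h.exists_one_sub_norm_le ht
  obtain ⟨δ, hδ, hδU⟩ := Metric.mem_nhdsWithin_iff.1 (mem_iSup.1 hU ((|E| + 1) * M * K))
  have hnear : ball σ (δ / (|E| + 1)) ∈ 𝓝[stolz σ M] σ :=
    nhdsWithin_le_nhds (ball_mem_nhds σ (by positivity))
  filter_upwards [hnear, self_mem_nhdsWithin] with z hzσ hzM s hs hle
  have hz : z ∈ disk := mem_disk.2 hzM.1
  have hM := pos_of_mem_stolz hzM
  have hle' : ‖φ s z - σ‖ ≤ (|E| + 1) * ‖z - σ‖ :=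
    hle.trans (by gcongr; linarith [le_abs_self E])
  refine hδU ⟨?_, mem_disk.1 (h.semigroup.mapsTo s hs.1 hz), ?_⟩
  · rw [mem_ball, dist_eq_norm] at hzσ ⊢
    rw [lt_div_iff₀' (by positivity)] at hzσ
    exact hle'.trans_lt hzσ
  · calc ‖σ - φ s z‖ ≤ (|E| + 1) * ‖σ - z‖ := by rwa [norm_sub_rev, norm_sub_rev σ]
      _ < (|E| + 1) * (M * (1 - ‖z‖)) := by gcongr; exact hzM.2
      _ ≤ (|E| + 1) * (M * (K * (1 - ‖φ s z‖))) := by gcongr; exact hK s hs z hz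
      _ = (|E| + 1) * M * K * (1 - ‖φ s z‖) := by ring

theorem exists_eventually_norm_sub_le (h : IsGeneratorOf G φ) (hσ : ‖σ‖ = 1)
    (hc : Tendsto (fun z => G z / (z - σ)) (angular σ) (𝓝 c)) (ht : 0 ≤ t) (M : ℝ) :
    ∃ E : ℝ, ∀ᶠ z in 𝓝[stolz σ M] σ, ∀ s ∈ Icc 0 t, ‖φ s z - σ‖ ≤ E * ‖z - σ‖ := by
  set C := ‖c‖ + 1
  have : 0 < C := by positivity
  have hbounded : {w | ‖G w / (w - σ)‖ < C} ∈ angular σ :=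
    hc.norm.eventually_lt_const (lt_add_one _)
  refine ⟨Real.exp (C * t) + 1, ?_⟩
  filter_upwards [h.eventually_mem_of_norm_sub_le ht hbounded (Real.exp (C * t) + 1) M,
    self_mem_nhdsWithin] with z hmem hzM
  have hz : z ∈ disk := mem_disk.2 hzM.1
  have hpos : 0 < ‖z - σ‖ := norm_pos_iff.2 (sub_ne_zero.2 (ne_of_mem_disk hσ hz))
  have hstay : ∀ s ∈ Icc 0 t, ‖φ s z - σ‖ < (Real.exp (C * t) + 1) * ‖z - σ‖ := by
    refine lt_of_forall_le_imp_lt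
      ((h.isTrajectory hz t).continuousOn.sub continuousOn_const).norm ?_ fun s hs hle => ?_
    · rw [h.semigroup.zero z hz]
      exact lt_mul_of_one_lt_left hpos (lt_add_of_pos_left _ (Real.exp_pos _))
    · have hexp := norm_exp_integral_le hs.1 fun r hr =>
        (hmem r ⟨hr.1, hr.2.trans hs.2⟩ (hle r hr)).le
      rw [h.sub_eq hσ hz hs.1, norm_mul, mul_comm]
      gcongr
      calc _ ≤ Real.exp (C * s) := hexp
        _ ≤ Real.exp (C * t) := by gcongr; exact hs.2
        _ < Real.exp (C * t) + 1 := lt_add_one _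
  exact fun s hs => (hstay s hs).le

theorem tendstoUniformlyOn_div_sub (h : IsGeneratorOf G φ) (hσ : ‖σ‖ = 1)
    (hc : Tendsto (fun z => G z / (z - σ)) (angular σ) (𝓝 c)) (ht : 0 ≤ t) (M : ℝ) :
    TendstoUniformlyOn (fun z s => G (φ s z) / (φ s z - σ)) (fun _ => c) (𝓝[stolz σ M] σ)
      (Icc 0 t) := fun u hu => by
  obtain ⟨E, hE⟩ := h.exists_eventually_norm_sub_le hσ hc ht M
  have hmem := h.eventually_mem_of_norm_sub_le ht (hc (UniformSpace.ball_mem_nhds c hu)) E M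
  filter_upwards [hE, hmem] with z hzE hz s hs
  exact hz s hs (hzE s hs)

theorem tendsto_div_sub (h : IsGeneratorOf G φ) (hσ : ‖σ‖ = 1)
    (hc : Tendsto (fun z => G z / (z - σ)) (angular σ) (𝓝 c)) (ht : 0 ≤ t) :
    Tendsto (fun z => (φ t z - σ) / (z - σ)) (angular σ) (𝓝 (Complex.exp (t * c))) := by
  have hint : Tendsto (fun z => ∫ s in (0 : ℝ)..t, G (φ s z) / (φ s z - σ)) (angular σ)
      (𝓝 (t * c)) := by
    refine tendsto_angular_iff.2 fun M => ?_
    have hunif := h.tendstoUniformlyOn_div_sub hσ hc ht M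
    rw [← uIcc_of_le ht] at hunif
    have hlim := hunif.tendsto_intervalIntegral_of_continuousOn (μ := MeasureTheory.volume) (by
      filter_upwards [self_mem_nhdsWithin] with z hz
      rw [uIcc_of_le ht]
      exact h.continuousOn_div_sub hσ (mem_disk.2 hz.1) t)
    rwa [intervalIntegral.integral_const, sub_zero, Complex.real_smul] at hlim
  refine hint.cexp.congr' ?_
  filter_upwards [eventually_angular_mem_disk σ] with z hz
  rw [h.sub_eq hσ hz ht, mul_div_cancel_left₀ _ (sub_ne_zero.2 (ne_of_mem_disk hσ hz))]

theorem hasBRFPWithDeriv (h : IsGeneratorOf G φ) (hσ : ‖σ‖ = 1) {l : ℝ}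
    (hl : HasSpectralValue G σ l) (ht : 0 ≤ t) :
    HasBRFPWithDeriv (φ t) σ (Real.exp (-(l * t)) : ℝ) := by
  have hc : Tendsto (fun z => G z / (z - σ)) (angular σ) (𝓝 (-l)) :=
    hl.neg.congr fun z => by rw [← div_neg, neg_sub]
  have hderiv := h.tendsto_div_sub hσ hc ht
  rw [show (t : ℂ) * -l = ((-(l * t) : ℝ) : ℂ) by push_cast; ring, ← Complex.ofReal_exp] at hderiv
  have hdist : Tendsto (fun z => z - σ) (angular σ) (𝓝 0) := by
    simpa only [sub_self, id] using (tendsto_id.mono_left (angular_le_nhds σ)).sub_const σ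
  have hfixed := (hderiv.mul hdist).add_const σ
  rw [mul_zero, zero_add] at hfixed
  refine ⟨hσ, hfixed.congr' ?_, hderiv⟩
  filter_upwards [eventually_angular_mem_disk σ] with z hz
  rw [div_mul_cancel₀ _ (sub_ne_zero.2 (ne_of_mem_disk hσ hz)), sub_add_cancel]

end IsGeneratorOf

/-! ### The Berkson–Porta formula -/

/-- The Berkson–Porta form of a vector field `G` on the disk, with distinguished point `τ` and
Herglotz factor `q`. It is only used for `‖τ‖ ≤ 1`, when `τ` turns out to be the Denjoy--Wolff
point. -/
structure IsBerksonPorta (τ : ℂ) (q G : ℂ → ℂ) : Prop where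
  herglotz : IsHerglotz q
  eq : ∀ z ∈ disk, G z = (τ - z) * (1 - conj τ * z) * q z

theorem re_conj_mul_berksonPorta (τ z c : ℂ) :
    (conj z * ((τ - z) * (1 - conj τ * z) * c)).re
      = -(‖τ - z‖ ^ 2 * c.re) + (1 - ‖z‖ ^ 2) * (conj τ * (τ - z) * c).re := by
  have hcomplex : conj z * ((τ - z) * (1 - conj τ * z) * c)
      = -(((‖τ - z‖ ^ 2 : ℝ) : ℂ) * c) + ((1 - ‖z‖ ^ 2 : ℝ) : ℂ) * (conj τ * (τ - z) * c) := by
    push_cast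
    rw [← Complex.conj_mul', ← Complex.conj_mul', map_sub]
    ring
  rw [hcomplex, Complex.add_re, Complex.neg_re, Complex.re_ofReal_mul, Complex.re_ofReal_mul]

theorem hasDerivWithinAt_lyapunov {τ c : ℂ} {γ : ℝ → ℂ} {s : Set ℝ} {t : ℝ} (hτ : ‖τ‖ ≤ 1)
    (hmem : γ t ∈ disk)
    (hγ : HasDerivWithinAt γ ((τ - γ t) * (1 - conj τ * γ t) * c) s t) :
    HasDerivWithinAt (fun r => lyapunov τ (γ r))
      (2 * ‖τ - γ t‖ ^ 2 * c.re / ‖1 - conj τ * γ t‖ ^ 2) s t := by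
  have hne := norm_ne_zero_iff.2 (one_sub_conj_mul_ne_zero hmem hτ)
  have hnum := hγ.norm_sq.const_sub 1
  have hden := ((hγ.const_mul (conj τ)).const_sub 1).norm_sq
  refine (hnum.div hden (pow_ne_zero 2 hne)).congr_deriv ?_
  have hden' : (-(conj τ * ((τ - γ t) * (1 - conj τ * γ t) * c)) * conj (1 - conj τ * γ t)).re
      = -(‖1 - conj τ * γ t‖ ^ 2 * (conj τ * (τ - γ t) * c).re) := by
    rw [← Complex.re_ofReal_mul, Complex.ofReal_pow, ← Complex.mul_conj', ← Complex.neg_re]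
    congr 1
    ring
  rw [Complex.inner, Complex.inner, hden', mul_comm _ (conj (γ t)), re_conj_mul_berksonPorta]
  field_simp
  ring

theorem exists_mem_disk_ne (τ : ℂ) : ∃ w ∈ disk, w ≠ τ := by
  by_cases h : τ = 0
  · exact ⟨1 / 2, mem_disk.2 (by norm_num), by rw [h]; norm_num⟩
  · exact ⟨0, zero_mem_disk, Ne.symm h⟩

theorem IsGeneratorOf.apply_eq_of_zero {G : ℂ → ℂ} {φ : ℝ → ℂ → ℂ} {w : ℂ} {t : ℝ}
    (h : IsGeneratorOf G φ) (hw : w ∈ disk) (h0 : G w = 0) (ht : 0 ≤ t) : φ t w = w := by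
  have hconst : IsTrajectory G t fun _ => w := fun s _ =>
    ⟨hw, h0.symm ▸ hasDerivWithinAt_const _ _ _⟩
  exact (h.isTrajectory hw t).eqOn h.holo hconst (h.semigroup.zero w hw) ⟨ht, le_rfl⟩

theorem IsHerglotz.mul_norm_add_conj_le {q : ℂ → ℂ} (hq : IsHerglotz q) {z : ℂ} (hz : z ∈ disk)
    (a : ℝ) : (1 - ‖z‖ ^ 2) * (a * ‖q z + conj (q 0)‖)
      ≤ a ^ 2 * (q z).re + (1 - ‖z‖ ^ 2) * (q 0).re := by
  have hd := one_sub_norm_sq_pos hz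
  have hqz := hq.re_nonneg z hz
  have hq0 := hq.re_nonneg 0 zero_mem_disk
  have hpick : (1 - ‖z‖ ^ 2) * ‖q z + conj (q 0)‖ ^ 2 ≤ 4 * (q z).re * (q 0).re := by
    simpa using hq.norm_sq_add_conj_mul_le hz zero_mem_disk
  -- By AM–GM the right side dominates the geometric mean of its summands, which `hpick` controls.
  refine (abs_le_of_sq_le_sq' ?_ (by positivity)).2
  calc ((1 - ‖z‖ ^ 2) * (a * ‖q z + conj (q 0)‖)) ^ 2
      = (1 - ‖z‖ ^ 2) * a ^ 2 * ((1 - ‖z‖ ^ 2) * ‖q z + conj (q 0)‖ ^ 2) := by ring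
    _ ≤ (1 - ‖z‖ ^ 2) * a ^ 2 * (4 * (q z).re * (q 0).re) := by gcongr
    _ = 4 * (a ^ 2 * (q z).re) * ((1 - ‖z‖ ^ 2) * (q 0).re) := by ring
    _ ≤ (a ^ 2 * (q z).re + (1 - ‖z‖ ^ 2) * (q 0).re) ^ 2 := four_mul_le_sq_add _ _

namespace IsBerksonPorta

variable {τ z w : ℂ} {q G : ℂ → ℂ} {φ : ℝ → ℂ → ℂ} {t : ℝ}

theorem differentiableOn (hG : IsBerksonPorta τ q G) : DifferentiableOn ℂ G disk :=
  (DifferentiableOn.mul (by fun_prop) hG.herglotz.holo).congr hG.eq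

theorem radiallyBounded (hG : IsBerksonPorta τ q G) (hτ : ‖τ‖ ≤ 1) :
    RadiallyBounded G (3 * ‖q 0‖) := fun z hz => by
  have hd := one_sub_norm_sq_pos hz
  have hdist : ‖τ - z‖ ≤ 2 := by linarith [norm_sub_le τ z, mem_disk.1 hz]
  have hqz : ‖q z‖ ≤ ‖q z + conj (q 0)‖ + ‖q 0‖ := by
    simpa using norm_sub_le (q z + conj (q 0)) (conj (q 0))
  have hamgm := hG.herglotz.mul_norm_add_conj_le hz ‖τ - z‖
  have hre : (conj τ * (τ - z) * q z).re ≤ ‖τ - z‖ * ‖q z‖ := calc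
    _ ≤ ‖conj τ * (τ - z) * q z‖ := Complex.re_le_norm _
    _ = ‖τ‖ * (‖τ - z‖ * ‖q z‖) := by rw [mul_assoc, norm_mul, norm_mul, Complex.norm_conj]
    _ ≤ ‖τ - z‖ * ‖q z‖ := mul_le_of_le_one_left (by positivity) hτ
  rw [hG.eq z hz, re_conj_mul_berksonPorta]
  calc -(‖τ - z‖ ^ 2 * (q z).re) + (1 - ‖z‖ ^ 2) * (conj τ * (τ - z) * q z).re
      ≤ -(‖τ - z‖ ^ 2 * (q z).re)
          + (1 - ‖z‖ ^ 2) * (‖τ - z‖ * (‖q z + conj (q 0)‖ + ‖q 0‖)) := by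
        gcongr
        exact hre.trans (by gcongr)
    _ ≤ (1 - ‖z‖ ^ 2) * ((q 0).re + ‖τ - z‖ * ‖q 0‖) := by linarith
    _ ≤ (1 - ‖z‖ ^ 2) * (‖q 0‖ + 2 * ‖q 0‖) := by
        gcongr
        exact Complex.re_le_norm _
    _ = 3 * ‖q 0‖ * (1 - ‖z‖ ^ 2) := by ring

theorem hasDerivWithinAt_lyapunov (hG : IsBerksonPorta τ q G) (hτ : ‖τ‖ ≤ 1)
    (h : IsGeneratorOf G φ) (hz : z ∈ disk) (ht : 0 ≤ t) :
    HasDerivWithinAt (fun s => lyapunov τ (φ s z))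
      (2 * ‖τ - φ t z‖ ^ 2 * (q (φ t z)).re / ‖1 - conj τ * φ t z‖ ^ 2) (Ici 0) t := by
  have hmem := h.semigroup.mapsTo t ht hz
  exact DiskSemigroup.hasDerivWithinAt_lyapunov hτ hmem (hG.eq _ hmem ▸ h.flow z hz t ht)

theorem monotoneOn_lyapunov (hG : IsBerksonPorta τ q G) (hτ : ‖τ‖ ≤ 1) (h : IsGeneratorOf G φ)
    (hz : z ∈ disk) : MonotoneOn (fun t => lyapunov τ (φ t z)) (Ici 0) :=
  monotoneOn_of_hasDerivWithinAt_nonneg (convex_Ici 0)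
    (fun t ht => (hG.hasDerivWithinAt_lyapunov hτ h hz ht).continuousWithinAt)
    (fun t ht => (hG.hasDerivWithinAt_lyapunov hτ h hz (interior_subset ht)).mono interior_subset)
    fun t ht => by
      have := hG.herglotz.re_nonneg _ (h.semigroup.mapsTo t (interior_subset ht) hz)
      positivity

theorem eq_of_apply_eq (hG : IsBerksonPorta τ q G) (hτ : ‖τ‖ ≤ 1) (h : IsGeneratorOf G φ)
    (hw : w ∈ disk) (hq : 0 < (q w).re) (ht : 0 < t) (hfix : φ t w = w) : w = τ := by
  have hmono := hG.monotoneOn_lyapunov hτ h hw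
  have hzero := h.semigroup.zero w hw
  have hconst : ∀ s ∈ Icc 0 t, lyapunov τ (φ s w) = lyapunov τ w := fun s hs => by
    refine le_antisymm ?_ ?_
    · simpa only [hfix] using hmono hs.1 ht.le hs.2
    · simpa only [hzero] using hmono self_mem_Ici hs.1 hs.1
  have hder := (hG.hasDerivWithinAt_lyapunov hτ h hw le_rfl).mono
    (Icc_subset_Ici_self : Icc 0 t ⊆ Ici 0)
  have hder0 := (hasDerivWithinAt_const 0 (Icc 0 t) (lyapunov τ w)).congr hconst
    (hconst 0 ⟨le_rfl, ht.le⟩)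
  have hvanish := (uniqueDiffOn_Icc ht 0 ⟨le_rfl, ht.le⟩).eq_deriv _ hder hder0
  have hne := norm_ne_zero_iff.2 (one_sub_conj_mul_ne_zero hw hτ)
  rw [hzero, div_eq_zero_iff, or_iff_left (pow_ne_zero 2 hne), mul_eq_zero,
    or_iff_left hq.ne', mul_eq_zero, or_iff_right two_ne_zero, sq_eq_zero_iff, norm_eq_zero,
    sub_eq_zero] at hvanish
  exact hvanish.symm

theorem hasSpectralValue (hG : IsBerksonPorta τ q G) (hτ : ‖τ‖ = 1) {m : ℝ}
    (hm : HasStar q τ m) : HasSpectralValue G τ m := by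
  refine hm.congr' ?_
  filter_upwards [eventually_angular_mem_disk τ] with z hz
  rw [hG.eq z hz, mul_assoc, mul_div_cancel_left₀ _ (sub_ne_zero_of_mem_disk hτ hz)]

theorem isDWPoint (hG : IsBerksonPorta τ q G) (hτ : ‖τ‖ ≤ 1) (h : IsGeneratorOf G φ)
    (hq : ∀ z ∈ disk, 0 < (q z).re) (ht : 0 < t) : IsDWPoint (φ t) τ := by
  have hfixed : ∀ w ∈ disk, φ t w = w → w = τ := fun w hw =>
    hG.eq_of_apply_eq hτ h hw (hq w hw) ht
  rcases hτ.lt_or_eq with hlt | heq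
  · have hτd := mem_disk.2 hlt
    have hfix := h.apply_eq_of_zero hτd (by rw [hG.eq τ hτd, sub_self, zero_mul, zero_mul]) ht.le
    exact Or.inl ⟨hτd, hfix, hfixed, norm_deriv_le_one_of_fixed (h.semigroup.holo t ht.le)
      (h.semigroup.mapsTo t ht.le) hτd hfix⟩
  · obtain ⟨m, hm0, -, hm⟩ := hG.herglotz.exists_star heq
    have hl : HasSpectralValue G τ (2 * m : ℝ) := hG.hasSpectralValue heq (by exact_mod_cast hm)
    exact Or.inr ⟨fun w hw he => ne_of_mem_disk heq hw (hfixed w hw he), _,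
      h.hasBRFPWithDeriv heq hl ht.le, Real.exp_le_one_iff.2 (neg_nonpos.2 (by positivity))⟩

theorem isSemigroupDWPoint (hG : IsBerksonPorta τ q G) (hτ : ‖τ‖ ≤ 1) (h : IsGeneratorOf G φ)
    (hq : ∀ z ∈ disk, 0 < (q z).re) : IsSemigroupDWPoint φ τ := by
  obtain ⟨w, hw, hwτ⟩ := exists_mem_disk_ne τ
  exact ⟨⟨1, one_pos, fun hid => hwτ (hG.eq_of_apply_eq hτ h hw (hq w hw) one_pos (hid hw))⟩,
    fun t ht _ => hG.isDWPoint hτ h hq ht⟩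

end IsBerksonPorta

/-! ### Julia's lemma -/

section Julia

variable {f : ℂ → ℂ} {τ z : ℂ} (hf : DifferentiableOn ℂ f disk) (hmaps : MapsTo f disk disk)

include hmaps in
theorem HasBRFPWithDeriv.hasStar_cayley_comp_mul_eq {a b : ℂ} (h : HasBRFPWithDeriv f τ a)
    (hb : HasStar (fun z => cayley τ (f z)) τ b) : b * a = 2 := by
  have hτ := h.norm_eq
  have := angular_neBot hτ
  have hlim := (h.fixed.const_add τ).const_mul (conj τ)
  rw [mul_add, conj_mul_self_of_norm_eq_one hτ, one_add_one_eq_two] at hlim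
  refine tendsto_nhds_unique (Tendsto.mul hb h.angularDeriv) (hlim.congr' ?_)
  filter_upwards [eventually_angular_mem_disk τ] with w hw
  have hw' := sub_ne_zero_of_mem_disk hτ hw
  have hfw := sub_ne_zero_of_mem_disk hτ (hmaps hw)
  rw [one_sub_conj_mul_eq hτ, cayley, ← neg_sub τ, ← neg_sub τ, neg_div_neg_eq]
  field_simp

include hf hmaps

theorem lyapunov_le_of_fixed (hτ : τ ∈ disk) (hfix : f τ = τ) (hz : z ∈ disk) :
    lyapunov τ z ≤ lyapunov τ (f z) := by
  have hpick := one_sub_norm_sq_mul_le hf hmaps hz hτ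
  have hne := norm_pos_iff.2 (one_sub_conj_mul_ne_zero hz (mem_disk.1 hτ).le)
  have hfne := norm_pos_iff.2 (one_sub_conj_mul_ne_zero (hmaps hz) (mem_disk.1 hτ).le)
  rw [hfix] at hpick
  rw [lyapunov, lyapunov, div_le_div_iff₀ (by positivity) (by positivity)]
  refine le_of_mul_le_mul_right ?_ (one_sub_norm_sq_pos hτ)
  linarith

theorem HasBRFPWithDeriv.lyapunov_le {a : ℝ} (h : HasBRFPWithDeriv f τ a) (ha : a ≤ 1)
    (hz : z ∈ disk) : lyapunov τ z ≤ lyapunov τ (f z) := by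
  have hτ := h.norm_eq
  have hcomp : IsHerglotz fun z => cayley τ (f z) :=
    ⟨(isHerglotz_cayley hτ).holo.comp hf hmaps,
      fun z hz => (isHerglotz_cayley hτ).re_nonneg _ (hmaps hz)⟩
  obtain ⟨m, hm0, hrest, hm⟩ := hcomp.exists_star hτ
  have hma : 2 * m * a = 2 := by
    exact_mod_cast h.hasStar_cayley_comp_mul_eq hmaps hm
  have hm1 : 1 ≤ m := by nlinarith
  have hre := hrest.re_nonneg z hz
  rw [Complex.sub_re, Complex.re_ofReal_mul, re_cayley hτ, re_cayley hτ, sub_nonneg] at hre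
  exact (le_mul_of_one_le_left (lyapunov_pos hτ.le hz).le hm1).trans hre

theorem IsDWPoint.lyapunov_le (h : IsDWPoint f τ) (hz : z ∈ disk) :
    lyapunov τ z ≤ lyapunov τ (f z) := by
  rcases h with ⟨hτ, hfix, -, -⟩ | ⟨-, a, ha, ha1⟩
  · exact lyapunov_le_of_fixed hf hmaps hτ hfix hz
  · exact ha.lyapunov_le hf hmaps ha1 hz

end Julia

namespace IsSemigroupDWPoint

variable {φ : ℝ → ℂ → ℂ} {τ z : ℂ} {t : ℝ}

theorem lyapunov_le (hτ : IsSemigroupDWPoint φ τ) (h : IsSemigroup φ) (ht : 0 ≤ t)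
    (hz : z ∈ disk) : lyapunov τ z ≤ lyapunov τ (φ t z) := by
  rcases ht.eq_or_lt with rfl | hpos
  · rw [h.zero z hz]
  by_cases hid : EqOn (φ t) id disk
  · rw [hid hz, id]
  · exact (hτ.2 t hpos hid).lyapunov_le (h.holo t ht) (h.mapsTo t ht) hz

theorem monotoneOn_lyapunov (hτ : IsSemigroupDWPoint φ τ) (h : IsSemigroup φ) (hz : z ∈ disk) :
    MonotoneOn (fun t => lyapunov τ (φ t z)) (Ici 0) := fun s hs t _ hst => by
  have hle := hτ.lyapunov_le h (sub_nonneg.2 hst) (h.mapsTo s hs hz)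
  rwa [← h.add _ _ (sub_nonneg.2 hst) hs z hz, sub_add_cancel] at hle

theorem apply_eq (hτ : IsSemigroupDWPoint φ τ) (h : IsSemigroup φ) (hτd : τ ∈ disk) (ht : 0 ≤ t) :
    φ t τ = τ := by
  rcases ht.eq_or_lt with rfl | hpos
  · exact h.zero τ hτd
  by_cases hid : EqOn (φ t) id disk
  · exact hid hτd
  · rcases hτ.2 t hpos hid with ⟨-, hfix, -⟩ | ⟨-, a, ha, -⟩
    · exact hfix
    · exact absurd rfl (ne_of_mem_disk ha.norm_eq hτd)

end IsSemigroupDWPoint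

theorem exists_berksonPorta_factor {G : ℂ → ℂ} {τ : ℂ} (hG : DifferentiableOn ℂ G disk)
    (hτ : ‖τ‖ ≤ 1) (h0 : τ ∈ disk → G τ = 0) :
    ∃ q, DifferentiableOn ℂ q disk ∧ ∀ z ∈ disk, G z = (τ - z) * (1 - conj τ * z) * q z := by
  obtain ⟨r, hr, hGr⟩ : ∃ r, DifferentiableOn ℂ r disk ∧ ∀ z ∈ disk, G z = (τ - z) * r z := by
    rcases hτ.lt_or_eq with hlt | heq
    · have hτd := mem_disk.2 hlt
      refine ⟨fun z => -dslope G τ z,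
        ((Complex.differentiableOn_dslope (disk_mem_nhds hτd)).2 hG).neg, fun z _ => ?_⟩
      have hslope := sub_smul_dslope G τ z
      rw [h0 hτd, sub_zero, smul_eq_mul] at hslope
      rw [← hslope, mul_neg, ← neg_mul, neg_sub]
    · exact ⟨fun z => G z / (τ - z), hG.div (by fun_prop) fun z => sub_ne_zero_of_mem_disk heq,
        fun z hz => (mul_div_cancel₀ _ (sub_ne_zero_of_mem_disk heq hz)).symm⟩
  refine ⟨fun z => r z / (1 - conj τ * z),
    hr.div (by fun_prop) fun z hz => one_sub_conj_mul_ne_zero hz hτ, fun z hz => ?_⟩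
  rw [hGr z hz, mul_assoc, mul_div_cancel₀ _ (one_sub_conj_mul_ne_zero hz hτ)]

theorem isHerglotz_of_forall_ne_re_nonneg {q : ℂ → ℂ} {w : ℂ} (hq : DifferentiableOn ℂ q disk)
    (hre : ∀ z ∈ disk, z ≠ w → 0 ≤ (q z).re) : IsHerglotz q := by
  refine ⟨hq, fun z hz => ?_⟩
  rcases eq_or_ne z w with rfl | hne
  · have hcont : ContinuousAt (fun z => (q z).re) z :=
      Complex.continuous_re.continuousAt.comp (hq.continuousOn.continuousAt (disk_mem_nhds hz))
    refine ge_of_tendsto (hcont.tendsto.mono_left (nhdsWithin_le_nhds (s := {z}ᶜ))) ?_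
    filter_upwards [self_mem_nhdsWithin, nhdsWithin_le_nhds (disk_mem_nhds hz)] with ζ hζz hζ
    exact hre ζ hζ hζz
  · exact hre z hz hne

namespace IsGeneratorOf

variable {G : ℂ → ℂ} {φ : ℝ → ℂ → ℂ} {τ : ℂ}

theorem eq_zero_of_forall_apply_eq (h : IsGeneratorOf G φ) {w : ℂ} (hw : w ∈ disk)
    (hfix : ∀ t, 0 ≤ t → φ t w = w) : G w = 0 := by
  have hder := h.flow w hw 0 le_rfl
  rw [hfix 0 le_rfl] at hder
  exact (uniqueDiffWithinAt_Ici 0).eq_deriv _ hder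
    ((hasDerivWithinAt_const 0 (Ici 0) w).congr hfix (hfix 0 le_rfl))

theorem exists_isBerksonPorta (h : IsGeneratorOf G φ) (hτ : ‖τ‖ ≤ 1)
    (hDW : IsSemigroupDWPoint φ τ) : ∃ q, IsBerksonPorta τ q G := by
  obtain ⟨q, hq, hGq⟩ := exists_berksonPorta_factor h.holo hτ fun hτd =>
    h.eq_zero_of_forall_apply_eq hτd fun _ => hDW.apply_eq h.semigroup hτd
  refine ⟨q, isHerglotz_of_forall_ne_re_nonneg (w := τ) hq fun z hz hzτ => ?_, hGq⟩
  have hflow := h.flow z hz 0 le_rfl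
  have hzero := h.semigroup.zero z hz
  rw [hzero, hGq z hz] at hflow
  have hder := hasDerivWithinAt_lyapunov (γ := fun t => φ t z) (t := 0) hτ
    (h.semigroup.mapsTo 0 le_rfl hz) (by rwa [hzero])
  have hnonneg := hder.nonneg_of_monotoneOn (uniqueDiffWithinAt_Ici 0).accPt
    (hDW.monotoneOn_lyapunov h.semigroup hz)
  have hdist := norm_pos_iff.2 (sub_ne_zero.2 hzτ.symm)
  have hden := norm_pos_iff.2 (one_sub_conj_mul_ne_zero hz hτ)
  rw [hzero, le_div_iff₀ (by positivity), zero_mul] at hnonneg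
  exact nonneg_of_mul_nonneg_right hnonneg (by positivity)

end IsGeneratorOf

/-! ### Spectral values and atoms of the denominator -/

theorem HasSpectralValue.unique {G : ℂ → ℂ} {σ : ℂ} {l l' : ℝ} (hσ : ‖σ‖ = 1)
    (hl : HasSpectralValue G σ l) (hl' : HasSpectralValue G σ l') : l = l' :=
  have := angular_neBot hσ
  Complex.ofReal_injective (tendsto_nhds_unique hl hl')

theorem HasSpectralValue.not_eqOn_zero {G : ℂ → ℂ} {σ : ℂ} {l : ℝ} (hσ : ‖σ‖ = 1)
    (hl : HasSpectralValue G σ l) (hl0 : l ≠ 0) : ¬ EqOn G 0 disk := fun h0 => by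
  refine hl0 (hl.unique hσ (tendsto_const_nhds.congr' ?_))
  filter_upwards [eventually_angular_mem_disk σ] with z hz
  rw [h0 hz, Pi.zero_apply, zero_div, Complex.ofReal_zero]

section SpectralValue

variable {τ σ : ℂ} {G P : ℂ → ℂ}

theorem tendsto_one_sub_conj_mul_mul_div_sub (hσ : ‖σ‖ = 1)
    (hGP : ∀ z ∈ disk, G z * P z = (τ - z) * (1 - conj τ * z)) :
    Tendsto (fun z => (1 - conj σ * z) * P z * (G z / (σ - z))) (angular σ)
      (𝓝 (-‖τ - σ‖ ^ 2 : ℝ)) := by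
  have hcont : Continuous fun z => conj σ * ((τ - z) * (1 - conj τ * z)) := by fun_prop
  have hlim := (hcont.tendsto σ).mono_left (angular_le_nhds σ)
  have hvalue : conj σ * ((τ - σ) * (1 - conj τ * σ)) = ((-‖τ - σ‖ ^ 2 : ℝ) : ℂ) := by
    push_cast
    rw [← Complex.mul_conj', map_sub]
    linear_combination (-(τ - σ) * conj τ) * conj_mul_self_of_norm_eq_one hσ
  rw [hvalue] at hlim
  refine hlim.congr' ?_
  filter_upwards [eventually_angular_mem_disk σ] with z hz
  have hne := sub_ne_zero_of_mem_disk hσ hz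
  rw [← hGP z hz, one_sub_conj_mul_eq hσ]
  field_simp

theorem HasStar.mul_spectralValue_eq {a l : ℝ} (hσ : ‖σ‖ = 1)
    (hGP : ∀ z ∈ disk, G z * P z = (τ - z) * (1 - conj τ * z)) (ha : HasStar P σ a)
    (hl : HasSpectralValue G σ l) : a * l = -‖τ - σ‖ ^ 2 := by
  have := angular_neBot hσ
  exact_mod_cast tendsto_nhds_unique (Tendsto.mul ha hl)
    (tendsto_one_sub_conj_mul_mul_div_sub hσ hGP)

theorem HasStar.hasSpectralValue {a l : ℝ} (hσ : ‖σ‖ = 1)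
    (hGP : ∀ z ∈ disk, G z * P z = (τ - z) * (1 - conj τ * z)) (ha : HasStar P σ a) (ha0 : a ≠ 0)
    (hal : a * l = -‖τ - σ‖ ^ 2) : HasSpectralValue G σ l := by
  have ha0' := Complex.ofReal_ne_zero.2 ha0
  have hlim := (tendsto_one_sub_conj_mul_mul_div_sub hσ hGP).div ha ha0'
  rw [← hal, Complex.ofReal_mul, mul_div_cancel_left₀ _ ha0'] at hlim
  refine hlim.congr' ?_
  filter_upwards [ha.eventually_ne ha0'] with z hz
  rw [Pi.div_apply, mul_div_cancel_left₀ _ hz]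

end SpectralValue

/-! ### The representation formula -/

theorem IsHerglotz.inv {q : ℂ → ℂ} (hq : IsHerglotz q) (h0 : ∀ z ∈ disk, q z ≠ 0) :
    IsHerglotz fun z => (q z)⁻¹ :=
  ⟨hq.holo.inv h0, fun z hz => by
    rw [Complex.inv_re]; exact div_nonneg (hq.re_nonneg z hz) (Complex.normSq_nonneg _)⟩

theorem continuousAt_sum_cayley {ι : Type*} {σ : ι → ℂ} (hinj : Function.Injective σ) (a : ι → ℝ)
    {s : Finset ι} {j : ι} (hj : j ∉ s) :
    ContinuousAt (fun z => ∑ k ∈ s, (a k : ℂ) * cayley (σ k) z) (σ j) :=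
  tendsto_finsetSum _ fun k hk => Tendsto.const_mul _ (continuousAt_cayley fun he =>
    hj (by rwa [hinj he])).tendsto

theorem IsHerglotz.sub_sum_cayley {ι : Type*} {P : ℂ → ℂ} (hP : IsHerglotz P) {σ : ι → ℂ}
    (hσ : ∀ k, ‖σ k‖ = 1) (hinj : Function.Injective σ) {a m : ι → ℝ} (ham : ∀ k, a k ≤ m k)
    (hstar : ∀ k, HasStar P (σ k) (2 * m k)) (s : Finset ι) :
    IsHerglotz fun z => P z - ∑ k ∈ s, (a k : ℂ) * cayley (σ k) z := by
  classical
  induction s using Finset.induction_on with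
  | empty => simpa only [Finset.sum_empty, sub_zero] using hP
  | insert j s hj ih =>
    obtain ⟨m', -, hrest, hm'⟩ := ih.exists_star (hσ j)
    -- The atom at `σ j` is not affected by the subtraction of the other atoms.
    have hm : m' = m j := by
      have hsub := (hstar j).add
        (hasStar_zero_of_continuousAt (hσ j) (continuousAt_sum_cayley hinj a hj).neg)
      rw [add_zero] at hsub
      have h2 := hm'.unique (hσ j) hsub
      exact_mod_cast mul_left_cancel₀ two_ne_zero h2
    have hsum := hrest.add ((isHerglotz_cayley (hσ j)).ofReal_mul (a := m' - a j)
      (sub_nonneg.2 (hm ▸ ham j)))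
    convert hsum using 2 with z
    rw [Finset.sum_insert hj, Complex.ofReal_sub]
    ring

theorem alpha_pos {τ σ : ℂ} (h : τ ≠ σ) {l : ℝ} (hl : l < 0) : 0 < alpha τ σ l :=
  div_pos (pow_pos (norm_pos_iff.2 (sub_ne_zero.2 h)) 2) (mul_pos two_pos (abs_pos.2 hl.ne))

theorem two_mul_alpha_mul (τ σ : ℂ) {l : ℝ} (hl : l < 0) :
    2 * alpha τ σ l * l = -‖τ - σ‖ ^ 2 := by
  have := hl.ne
  rw [alpha, abs_of_neg hl]
  field_simp

section Representation

variable {n : ℕ} {τ : ℂ} {σ : Fin n → ℂ} {lam : Fin n → ℝ} {p G : ℂ → ℂ}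

theorem p0_eq_sum_cayley (τ : ℂ) (σ : Fin n → ℂ) (lam : Fin n → ℝ) :
    p0 τ σ lam = fun z => ∑ k, (alpha τ (σ k) (lam k) : ℂ) * cayley (σ k) z :=
  rfl

theorem differentiableOn_p0 (hσ : ∀ k, ‖σ k‖ = 1) : DifferentiableOn ℂ (p0 τ σ lam) disk := by
  rw [p0_eq_sum_cayley]
  exact DifferentiableOn.fun_sum fun k _ => (isHerglotz_cayley (hσ k)).holo.const_mul _

theorem re_p0_pos (hn : 1 ≤ n) (hσ : ∀ k, ‖σ k‖ = 1) (hτσ : ∀ k, τ ≠ σ k)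
    (hlam : ∀ k, lam k < 0) {z : ℂ} (hz : z ∈ disk) : 0 < (p0 τ σ lam z).re := by
  rw [p0_eq_sum_cayley, Complex.re_sum]
  refine Finset.sum_pos (fun k _ => ?_) ⟨⟨0, hn⟩, Finset.mem_univ _⟩
  rw [Complex.re_ofReal_mul, re_cayley (hσ k)]
  exact mul_pos (alpha_pos (hτσ k) (hlam k)) (lyapunov_pos (hσ k).le hz)

theorem hasStar_p0 (hσ : ∀ k, ‖σ k‖ = 1) (hσinj : Function.Injective σ) (j : Fin n) :
    HasStar (p0 τ σ lam) (σ j) (2 * alpha τ (σ j) (lam j)) := by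
  have hrest := hasStar_zero_of_continuousAt (hσ j) (continuousAt_sum_cayley hσinj
    (fun k => alpha τ (σ k) (lam k)) (Finset.notMem_erase j Finset.univ))
  have hsum := ((hasStar_cayley_self (hσ j)).const_mul (alpha τ (σ j) (lam j))).add hrest
  rw [add_zero, mul_comm] at hsum
  convert hsum using 2 with z
  exact (Finset.add_sum_erase _ _ (Finset.mem_univ j)).symm

theorem re_add_p0_pos (hn : 1 ≤ n) (hσ : ∀ k, ‖σ k‖ = 1) (hτσ : ∀ k, τ ≠ σ k)
    (hlam : ∀ k, lam k < 0) (hp : IsHerglotz p) {z : ℂ} (hz : z ∈ disk) :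
    0 < (p z + p0 τ σ lam z).re := by
  rw [Complex.add_re]
  exact add_pos_of_nonneg_of_pos (hp.re_nonneg z hz) (re_p0_pos hn hσ hτσ hlam hz)

theorem add_p0_ne_zero (hn : 1 ≤ n) (hσ : ∀ k, ‖σ k‖ = 1) (hτσ : ∀ k, τ ≠ σ k)
    (hlam : ∀ k, lam k < 0) (hp : IsHerglotz p) {z : ℂ} (hz : z ∈ disk) :
    p z + p0 τ σ lam z ≠ 0 := fun h =>
  (re_add_p0_pos hn hσ hτσ hlam hp hz).ne' (congrArg Complex.re h)

theorem IsBerksonPorta.not_eqOn_zero {q : ℂ → ℂ} (hG : IsBerksonPorta τ q G) (hτ : ‖τ‖ ≤ 1)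
    (hq : ∀ z ∈ disk, q z ≠ 0) : ¬ EqOn G 0 disk := fun h0 => by
  obtain ⟨w, hw, hwτ⟩ := exists_mem_disk_ne τ
  exact mul_ne_zero (mul_ne_zero (sub_ne_zero.2 hwτ.symm) (one_sub_conj_mul_ne_zero hw hτ))
    (hq w hw) ((hG.eq w hw).symm.trans (h0 hw))

theorem IsBerksonPorta.exists_represents {q : ℂ → ℂ} (hG : IsBerksonPorta τ q G)
    (hq : ∀ z ∈ disk, q z ≠ 0) (hσ : ∀ k, ‖σ k‖ = 1) (hσinj : Function.Injective σ)
    (hlam : ∀ k, lam k < 0) (hl : ∀ k, ∃ l : ℝ, HasSpectralValue G (σ k) l ∧ lam k ≤ l) :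
    ∃ p, IsHerglotz p ∧ Represents τ σ lam p G := by
  have hinv := hG.herglotz.inv hq
  have hmul : ∀ z ∈ disk, G z * (q z)⁻¹ = (τ - z) * (1 - conj τ * z) := fun z hz => by
    rw [hG.eq z hz, mul_inv_cancel_right₀ (hq z hz)]
  have hatom : ∀ k, ∃ m : ℝ, alpha τ (σ k) (lam k) ≤ m ∧
      HasStar (fun z => (q z)⁻¹) (σ k) (2 * m) := fun k => by
    obtain ⟨m, hm0, -, hm⟩ := hinv.exists_star (hσ k)
    obtain ⟨l, hl, hle⟩ := hl k
    have hml := HasStar.mul_spectralValue_eq (a := 2 * m) (hσ k) hmul (by exact_mod_cast hm) hl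
    refine ⟨m, (mul_le_mul_right_of_neg (hlam k)).1 ?_, hm⟩
    linarith [mul_le_mul_of_nonneg_left hle hm0, two_mul_alpha_mul τ (σ k) (hlam k)]
  choose m hαm hm using hatom
  refine ⟨_, hinv.sub_sum_cayley hσ hσinj hαm hm Finset.univ, fun z hz => ?_⟩
  rw [p0_eq_sum_cayley, sub_add_cancel, div_inv_eq_mul, hG.eq z hz]

theorem exists_represents_of_mem_gen (hτ : ‖τ‖ ≤ 1) (hσ : ∀ k, ‖σ k‖ = 1)
    (hσinj : Function.Injective σ) (hlam : ∀ k, lam k < 0) (hG : G ∈ Gen τ σ lam)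
    (hG0 : ¬ EqOn G 0 disk) : ∃ p, IsHerglotz p ∧ Represents τ σ lam p G := by
  obtain ⟨φ, hφ, hDW, hk⟩ := hG
  obtain ⟨q, hq⟩ := hφ.exists_isBerksonPorta hτ (hDW.resolve_left hG0)
  refine hq.exists_represents (fun w hw hqw => hG0 fun z hz => ?_) hσ hσinj hlam fun k => ?_
  · rw [hq.eq z hz, hq.herglotz.eqOn_zero hw hqw hz, Pi.zero_apply, mul_zero]
  · obtain ⟨-, l, hl, hle, -⟩ := hk k
    exact ⟨l, hl, hle⟩

namespace Represents

theorem isBerksonPorta (hG : Represents τ σ lam p G) (hn : 1 ≤ n) (hσ : ∀ k, ‖σ k‖ = 1)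
    (hτσ : ∀ k, τ ≠ σ k) (hlam : ∀ k, lam k < 0) (hp : IsHerglotz p) :
    IsBerksonPorta τ (fun z => (p z + p0 τ σ lam z)⁻¹) G where
  herglotz := IsHerglotz.inv ⟨hp.holo.add (differentiableOn_p0 hσ), fun _ hz =>
    (re_add_p0_pos hn hσ hτσ hlam hp hz).le⟩ fun _ => add_p0_ne_zero hn hσ hτσ hlam hp
  eq z hz := by rw [hG z hz, div_eq_mul_inv]

theorem hasSpectralValue (hG : Represents τ σ lam p G) (hn : 1 ≤ n) (hσ : ∀ k, ‖σ k‖ = 1)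
    (hσinj : Function.Injective σ) (hτσ : ∀ k, τ ≠ σ k) (hlam : ∀ k, lam k < 0)
    (hp : IsHerglotz p) {k : Fin n} {m : ℝ} (hm0 : 0 ≤ m) (hm : HasStar p (σ k) (2 * m)) :
    HasSpectralValue G (σ k) (alpha τ (σ k) (lam k) / (m + alpha τ (σ k) (lam k)) * lam k) := by
  have hα := alpha_pos (hτσ k) (hlam k)
  have hstar : HasStar (fun z => p z + p0 τ σ lam z) (σ k)
      (2 * (m + alpha τ (σ k) (lam k)) : ℝ) := by
    rw [mul_add]
    exact_mod_cast hm.add (hasStar_p0 hσ hσinj k)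
  refine hstar.hasSpectralValue (τ := τ) (hσ k) (fun z hz => ?_) (by positivity) ?_
  · rw [hG z hz, div_mul_cancel₀ _ (add_p0_ne_zero hn hσ hτσ hlam hp hz)]
  · rw [← two_mul_alpha_mul τ (σ k) (hlam k)]
    field_simp

theorem mem_gen (hG : Represents τ σ lam p G) (hn : 1 ≤ n) (hτ : ‖τ‖ ≤ 1) (hσ : ∀ k, ‖σ k‖ = 1)
    (hσinj : Function.Injective σ) (hτσ : ∀ k, τ ≠ σ k) (hlam : ∀ k, lam k < 0)
    (hp : IsHerglotz p) : G ∈ Gen τ σ lam := by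
  have hq := hG.isBerksonPorta hn hσ hτσ hlam hp
  have hqpos : ∀ z ∈ disk, 0 < ((p z + p0 τ σ lam z)⁻¹).re := fun z hz => by
    rw [Complex.inv_re]
    exact div_pos (re_add_p0_pos hn hσ hτσ hlam hp hz)
      (Complex.normSq_pos.2 (add_p0_ne_zero hn hσ hτσ hlam hp hz))
  obtain ⟨φ, hφ⟩ := (hq.radiallyBounded hτ).exists_isGeneratorOf hq.differentiableOn
  refine ⟨φ, hφ, Or.inr (hq.isSemigroupDWPoint hτ hφ hqpos), fun k => ?_⟩
  obtain ⟨m, hm0, -, hm⟩ := hp.exists_star (hσ k)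
  have hα := alpha_pos (hτσ k) (hlam k)
  have hl := hG.hasSpectralValue hn hσ hσinj hτσ hlam hp hm0 hm
  have hle_one : alpha τ (σ k) (lam k) / (m + alpha τ (σ k) (lam k)) ≤ 1 :=
    (div_le_one (by positivity)).2 (le_add_of_nonneg_left hm0)
  exact ⟨fun t ht => ⟨_, hφ.hasBRFPWithDeriv (hσ k) hl ht⟩, _, hl,
    le_mul_of_le_one_left (hlam k).le hle_one,
    mul_nonpos_of_nonneg_of_nonpos (by positivity) (hlam k).le⟩

theorem not_eqOn_zero (hG : Represents τ σ lam p G) (hn : 1 ≤ n) (hτ : ‖τ‖ ≤ 1)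
    (hσ : ∀ k, ‖σ k‖ = 1) (hτσ : ∀ k, τ ≠ σ k) (hlam : ∀ k, lam k < 0) (hp : IsHerglotz p) :
    ¬ EqOn G 0 disk :=
  (hG.isBerksonPorta hn hσ hτσ hlam hp).not_eqOn_zero hτ fun _ hz =>
    inv_ne_zero (add_p0_ne_zero hn hσ hτσ hlam hp hz)

theorem hasSpectralValue_iff (hG : Represents τ σ lam p G) (hn : 1 ≤ n) (hσ : ∀ k, ‖σ k‖ = 1)
    (hσinj : Function.Injective σ) (hτσ : ∀ k, τ ≠ σ k) (hlam : ∀ k, lam k < 0)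
    (hp : IsHerglotz p) (k : Fin n) :
    HasSpectralValue G (σ k) (lam k) ↔ HasStar p (σ k) 0 := by
  have hα := alpha_pos (hτσ k) (hlam k)
  constructor
  · intro hl
    obtain ⟨m, hm0, -, hm⟩ := hp.exists_star (hσ k)
    have hratio := hl.unique (hσ k) (hG.hasSpectralValue hn hσ hσinj hτσ hlam hp hm0 hm)
    rw [eq_comm, mul_eq_right₀ (hlam k).ne, div_eq_one_iff_eq (by positivity),
      right_eq_add] at hratio
    rwa [hratio, Complex.ofReal_zero, mul_zero] at hm
  · intro h0
    have hl := hG.hasSpectralValue hn hσ hσinj hτσ hlam hp (k := k) le_rfl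
      (by rwa [Complex.ofReal_zero, mul_zero])
    rwa [zero_add, div_self hα.ne', one_mul] at hl

end Represents

end Representation

end DiskSemigroup

theorem mainTheorem1 {n : ℕ} (hn : 1 ≤ n) (τ : ℂ) (hτ : ‖τ‖ ≤ 1)
    (σ : Fin n → ℂ) (hσ : ∀ k, ‖σ k‖ = 1) (hσinj : Function.Injective σ)
    (hτσ : ∀ k, τ ≠ σ k) (lam : Fin n → ℝ) (hlam : ∀ k, lam k < 0) (G : ℂ → ℂ) :
    ((G ∈ DiskSemigroup.Gen τ σ lam ∧ ¬ Set.EqOn G 0 DiskSemigroup.disk) ↔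
      ∃ p : ℂ → ℂ, DiskSemigroup.IsHerglotz p ∧ DiskSemigroup.Represents τ σ lam p G) ∧
    (G ∈ DiskSemigroup.Gen' τ σ lam ↔
      ∃ p : ℂ → ℂ, DiskSemigroup.IsHerglotz p ∧ DiskSemigroup.Represents τ σ lam p G ∧
        ∀ k, DiskSemigroup.HasStar p (σ k) 0) := by
  refine ⟨⟨?_, ?_⟩, ⟨?_, ?_⟩⟩
  · rintro ⟨hG, hG0⟩
    exact DiskSemigroup.exists_represents_of_mem_gen hτ hσ hσinj hlam hG hG0
  · rintro ⟨p, hp, hR⟩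
    exact ⟨hR.mem_gen hn hτ hσ hσinj hτσ hlam hp, hR.not_eqOn_zero hn hτ hσ hτσ hlam hp⟩
  · rintro ⟨hG, hl⟩
    have hG0 := (hl ⟨0, hn⟩).not_eqOn_zero (hσ _) (hlam _).ne
    obtain ⟨p, hp, hR⟩ := DiskSemigroup.exists_represents_of_mem_gen hτ hσ hσinj hlam hG hG0
    exact ⟨p, hp, hR, fun k => (hR.hasSpectralValue_iff hn hσ hσinj hτσ hlam hp k).1 (hl k)⟩
  · rintro ⟨p, hp, hR, hstar⟩
    exact ⟨hR.mem_gen hn hτ hσ hσinj hτσ hlam hp, fun k =>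
      (hR.hasSpectralValue_iff hn hσ hσinj hτσ hlam hp k).2 (hstar k)⟩
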